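/- Let $k$ be an algebraically closed field, $r\ge 2$, and $R=k[x_0,\dots,x_r]$ with the standard grading. Let $X_1,X_2\subset\mathbb P^r$ be complete intersection schemes of codimension $2$, with $I_{X_1}=(f_1,g_1)$ and $I_{X_2}=(f_2,g_2)$, where $(f_1,g_1)$ and $(f_2,g_2)$ are regular sequences of forms with $\deg f_i=d_i$, $\deg g_i=e_i$. Assume that $X_1\cup X_2$ is arithmetically Cohen-Macaulay, that is, $R/(I_{X_1}\cap I_{X_2})$ is Cohen-Macaulay, that $d_2\ge d_1+e_1+e_2-2$, and that $(f_1,g_1,g_2)$ is a regular sequence. Then: 1. $d_1,e_1,e_2\le d_2$, and there are forms $a_1,b_1,b_2$ of degrees $d_2-d_1$, $d_2-e_1$, $d_2-e_2$ (possibly zero) with $f_2=a_1f_1+b_1g_1+b_2g_2$. 2. For every such expression of $f_2$ (even with $a_1,b_1,b_2\in R$ not homogeneous), the matrix $$M=\begin{pmatrix}-g_2&0\\ b_1&f_1\\ a_1&-g_1\end{pmatrix}$$ is a Hilbert-Burch matrix of $I_{X_1}\cap I_{X_2}$, i.e. its maximal minors generate this ideal and, with $\Delta$ the row of signed maximal minors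 of $M$, the sequence $0\to R^2\xrightarrow{M}R^3\xrightarrow{\Delta}I_{X_1}\cap I_{X_2}\to0$ is exact. Consequently $I_{X_1}\cap I_{X_2}=(f_2-b_2g_2,\ g_1g_2,\ f_1g_2)$. 3. If $a_1,b_1,b_2$ are forms as in 1, then $M$ and the generators $f_2-b_2g_2,\ g_1g_2,\ f_1g_2$ give a graded free resolution $$0\to R(-(d_2+e_2))\oplus R(-(e_1+e_2+d_1))\to R(-d_2)\oplus R(-(e_1+e_2))\oplus R(-(d_1+e_2))\to I_{X_1}\cap I_{X_2}\to 0.$$ It is minimal if and only if neither $a_1$ nor $b_1$ is a nonzero constant; in particular it is minimal whenever $d_2\ne d_1$ and $d_2\ne e_1$. 4. For an ideal $I$, an Artinian reduction is a quotient $R/(I+(\ell_1,\dots,\ell_s))$ that is Artinian, where $\ell_1,\dots,\ell_s$ are linear forms which are a regular sequence on $R/I$. The ideals $I_{X_1}\cap I_{X_2}$, $I_{X_1}$, $I_{X_2}$ have Artinian reductions, and for any Artinian reductions $A$, $A_1$, $A_2$ of them the Hilbert functions satisfy $$H_A(t)=H_{A_1}(t-e_2)+H_{A_2}(t)\qquad\text{for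 all } t\in\mathbb Z.$$ 5. If $d_2>d_1+e_1+e_2$, then for every Artinian reduction $A$ of $I_{X_1}\cap I_{X_2}$ the Hilbert function $H_A$ is not of decreasing type. Here $H$ is of decreasing type if $H(t+1)<H(t)$ implies that $H(s+1)<H(s)$ for all $s\ge t$ with $H(s)>0$. -/

import Mathlib

open MvPolynomial

/-- For a homogeneous ideal `I` of a polynomial ring: `R ⧸ I` is (graded) Cohen-Macaulay, i.e. there
is an `R ⧸ I`-regular sequence of forms of positive degree whose length is the Krull dimension of
`R ⧸ I`. If `I` is the saturated ideal of a closed subscheme `X` of projective space, this says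
that `X` is arithmetically Cohen-Macaulay. -/
def IsArithmeticallyCM {σ k : Type*} [Field k] (I : Ideal (MvPolynomial σ k)) : Prop :=
  ∃ rs : List (MvPolynomial σ k),
    (∀ x ∈ rs, ∃ n : ℕ, 0 < n ∧ x.IsHomogeneous n) ∧
    RingTheory.Sequence.IsRegular (MvPolynomial σ k ⧸ I) rs ∧
    ((rs.length : ℕ) : WithBot ℕ∞) = ringKrullDim (MvPolynomial σ k ⧸ I)

/-- The linear forms `ls` are a regular sequence on `R ⧸ I` and `A = R ⧸ (I + (ls))` is Artinian:
`A` is an Artinian reduction of (`R` modulo) `I`. -/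
structure IsArtinianReduction {σ k : Type*} [Field k] (I : Ideal (MvPolynomial σ k))
    (ls : List (MvPolynomial σ k)) : Prop where
  linear : ∀ l ∈ ls, l.IsHomogeneous 1
  regular : RingTheory.Sequence.IsRegular (MvPolynomial σ k ⧸ I) ls
  artinian : IsArtinianRing (MvPolynomial σ k ⧸ (I ⊔ Ideal.ofList ls))

/-- The Hilbert function `t ↦ dim_k (R ⧸ J)_t` of the graded ring `R ⧸ J`, for a homogeneous ideal
`J` of a polynomial ring in finitely many variables. The degree `t` part is the image of the forms
of degree `t`; it is zero for `t < 0`. -/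
noncomputable def hilbertFunction {σ k : Type*} [Field k] (J : Ideal (MvPolynomial σ k))
    (t : ℤ) : ℕ :=
  if t < 0 then 0
  else Module.finrank k
    ((homogeneousSubmodule σ k t.toNat).map (Ideal.Quotient.mkₐ k J).toLinearMap)

/-- The Hilbert function of the Artinian reduction of `I` given by the linear forms `ls`. -/
noncomputable def artinianHilbertFunction {σ k : Type*} [Field k] (I : Ideal (MvPolynomial σ k))
    (ls : List (MvPolynomial σ k)) : ℤ → ℕ :=
  hilbertFunction (I ⊔ Ideal.ofList ls)

/-- `H` is of decreasing type: once it has strictly decreased, it keeps strictly decreasing until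
it reaches zero. -/
def IsOfDecreasingType (H : ℤ → ℕ) : Prop :=
  ∀ t : ℤ, H (t + 1) < H t → ∀ s : ℤ, t ≤ s → 0 < H s → H (s + 1) < H s

/-- The maximal minor of an `(n + 1) × n` matrix obtained by deleting row `i`. -/
def maximalMinor {R : Type*} [CommRing R] {n : ℕ} (M : Matrix (Fin (n + 1)) (Fin n) R)
    (i : Fin (n + 1)) : R :=
  (M.submatrix i.succAbove id).det

/-- `M` is a Hilbert-Burch matrix of the ideal `I`: the maximal minors of `M` generate `I`, and with
`Δ = ((-1)^i Mᵢ)ᵢ` the vector of signed maximal minors, `0 → Rⁿ --M→ Rⁿ⁺¹ --Δ→ I → 0` is exact. -/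
structure IsHilbertBurchMatrix {R : Type*} [CommRing R] {n : ℕ}
    (M : Matrix (Fin (n + 1)) (Fin n) R) (I : Ideal R) : Prop where
  span_minors : Ideal.span (Set.range (maximalMinor M)) = I
  injective : Function.Injective M.mulVecLin
  exact : Function.Exact M.mulVecLin
    (Fintype.linearCombination R fun i : Fin (n + 1) => (-1 : R) ^ (i : ℕ) * maximalMinor M i)

/-- `0 → ⨁ⱼ R(-a j) --M→ ⨁ᵢ R(-b i) --φ→ I → 0` is a graded free resolution of the ideal `I` of the
polynomial ring `R`: both maps are homogeneous of degree `0` and the sequence is exact. -/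
structure IsGradedFreeResolution {σ k : Type*} [Field k] {p q : ℕ}
    (a : Fin p → ℕ) (b : Fin q → ℕ) (M : Matrix (Fin q) (Fin p) (MvPolynomial σ k))
    (φ : Fin q → MvPolynomial σ k) (I : Ideal (MvPolynomial σ k)) : Prop where
  homogeneous_gen : ∀ i, (φ i).IsHomogeneous (b i)
  homogeneous_matrix : ∀ i j, M i j ≠ 0 → b i ≤ a j ∧ (M i j).IsHomogeneous (a j - b i)
  injective : Function.Injective M.mulVecLin
  exact : Function.Exact M.mulVecLin (Fintype.linearCombination (MvPolynomial σ k) φ)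
  span_gen : Ideal.span (Set.range φ) = I

/-- The graded free resolution is minimal: the entries of `M` lie in the irrelevant maximal ideal
`(x₀, …, x_r)`. -/
structure IsMinimalGradedFreeResolution {σ k : Type*} [Field k] {p q : ℕ}
    (a : Fin p → ℕ) (b : Fin q → ℕ) (M : Matrix (Fin q) (Fin p) (MvPolynomial σ k))
    (φ : Fin q → MvPolynomial σ k) (I : Ideal (MvPolynomial σ k)) : Prop
    extends IsGradedFreeResolution a b M φ I where
  minimal : ∀ i j, M i j ∈ idealOfVars σ k

/-! Write `I₁ = (f₁, g₁)`, `I₂ = (f₂, g₂)`, `J = I₁ ⊓ I₂` and `L = I₁ + (g₂)`, so that `I₁ + I₂ = L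
+ (f₂)`. Everything rests on showing `f₂ ∈ L`.

Membership in `L` (`mem_span_of_isArithmeticallyCM`): the sequence `0 → R/J → R/I₁ ⊕ R/I₂ → R/(I₁ +
I₂) → 0` shows that `R/(I₁ + I₂)` has positive depth as long as `R/J` has depth at least two
(`hasDepth_one_sup`). A general linear form is then regular on all the quotients in sight, and
dividing by it commutes with the intersection (`inf_sup_span_eq`). After `r - 2` such steps `L`
becomes an Artinian complete intersection whose quotient has top degree `d₁ + e₁ + e₂ - 3 < d₂`, so
it contains `f₂`. Graded Nakayama carries this back to `L` one linear form at a time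
(`exists_linear_seq_of_mem_imp`).

Consequences: if `f₂ = a₁ f₁ + b₁ g₁ + b₂ g₂`, then `F = f₂ - b₂ g₂` lies in `J`, and `J = (F) + g₂
I₁` (`inf_span_pair_eq`). The syzygies follow from the regularity of the two pairs (`syzygy_iff`).
Moreover `J + (g₂) = I₂` and `J : g₂ = I₁`, which gives `0 → (R/I₁)(-e₂) → R/J → R/I₂ → 0` and adds
the Hilbert series (`hilbertSeries_inf`). Artinian reductions only strip powers of `1 - X`, so their
Hilbert functions add as well. For large `d₂` the summand of `I₂` is still on its plateau `e₂` when
the shifted summand of `I₁` dies out: the sum drops and then stays constant. -/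

/-! ### Regular elements and depth modulo an ideal. -/

section RegularModulo

variable {R : Type*} [CommRing R]

/-- `x` is a nonzerodivisor modulo the ideal `I`. -/
def RegularMod (I : Ideal R) (x : R) : Prop := ∀ w, x * w ∈ I → w ∈ I

/-- The list is a (weakly) regular sequence modulo the ideal `I`. -/
def RegularSeqMod : Ideal R → List R → Prop
  | _, [] => True
  | I, x :: xs => RegularMod I x ∧ RegularSeqMod (I ⊔ Ideal.span {x}) xs

/-- There is a regular sequence of length `m` modulo `I` consisting of elements of `𝔪`. -/
def HasDepth (𝔪 : Ideal R) : ℕ → Ideal R → Prop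
  | 0, _ => True
  | m + 1, I => ∃ x ∈ 𝔪, RegularMod I x ∧ HasDepth 𝔪 m (I ⊔ Ideal.span {x})

lemma isSMulRegular_quotient_iff_regularMod (I : Ideal R) (x : R) :
    IsSMulRegular (R ⧸ I) x ↔ RegularMod I x :=
  isSMulRegular_quotient_iff_mem_of_smul_mem I x

lemma mk_mem_ofList_smul_top_iff (I : Ideal R) (rs : List R) (w : R) :
    Submodule.Quotient.mk w ∈ (Ideal.ofList rs • ⊤ : Submodule R (R ⧸ I)) ↔
      w ∈ I ⊔ Ideal.ofList rs := by
  have h : (Ideal.ofList rs • ⊤ : Submodule R (R ⧸ I)) =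
      Submodule.map (Submodule.mkQ I) (Ideal.ofList rs) := by
    conv_rhs => rw [show Ideal.ofList rs = Ideal.ofList rs • (⊤ : Submodule R R) by simp]
    rw [Submodule.map_smul'', Submodule.map_top, Submodule.range_mkQ]
  rw [h, ← Submodule.mkQ_apply, ← Submodule.mem_comap, Submodule.comap_map_mkQ]

lemma isWeaklyRegular_quotient_iff (I : Ideal R) (rs : List R) :
    RingTheory.Sequence.IsWeaklyRegular (R ⧸ I) rs ↔
      ∀ i (h : i < rs.length), RegularMod (I ⊔ Ideal.ofList (rs.take i)) rs[i] := by
  rw [RingTheory.Sequence.isWeaklyRegular_iff]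
  refine forall₂_congr fun i h => ?_
  rw [isSMulRegular_quotient_iff_mem_of_smul_mem]
  constructor
  · intro H w hw
    rw [← mk_mem_ofList_smul_top_iff] at hw ⊢
    exact H _ hw
  · intro H w hw
    obtain ⟨w, rfl⟩ := Submodule.Quotient.mk_surjective _ w
    rw [mk_mem_ofList_smul_top_iff]
    refine H w ?_
    rw [← mk_mem_ofList_smul_top_iff]
    exact hw

lemma regularSeqMod_iff (I : Ideal R) (rs : List R) :
    RegularSeqMod I rs ↔
      ∀ i (h : i < rs.length), RegularMod (I ⊔ Ideal.ofList (rs.take i)) rs[i] := by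
  induction rs generalizing I with
  | nil => simp [RegularSeqMod]
  | cons x xs ih =>
    rw [RegularSeqMod, ih]
    constructor
    · rintro ⟨h0, h1⟩ (_ | i) hi
      · simpa using h0
      · simpa [sup_assoc] using h1 i (by simpa using hi)
    · intro H
      refine ⟨?_, fun i hi => ?_⟩
      · have := H 0 (by simp)
        simpa using! this
      · have := H (i + 1) (by simpa using hi)
        rw [List.take_succ_cons, Ideal.ofList_cons, ← sup_assoc] at this
        exact this

lemma isRegular_quotient_iff (I : Ideal R) (rs : List R) :
    RingTheory.Sequence.IsRegular (R ⧸ I) rs ↔ RegularSeqMod I rs ∧ I ⊔ Ideal.ofList rs ≠ ⊤ := by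
  rw [RingTheory.Sequence.isRegular_iff, isWeaklyRegular_quotient_iff, regularSeqMod_iff]
  refine and_congr_right fun _ => not_congr ?_
  rw [eq_comm, Submodule.eq_top_iff', Submodule.eq_top_iff',
    (Submodule.Quotient.mk_surjective I).forall]
  exact forall_congr' fun w => mk_mem_ofList_smul_top_iff I rs w

lemma isRegular_self_iff (rs : List R) :
    RingTheory.Sequence.IsRegular R rs ↔ RegularSeqMod ⊥ rs ∧ Ideal.ofList rs ≠ ⊤ := by
  have e : (R ⧸ (⊥ : Ideal R)) ≃ₗ[R] R := Submodule.quotEquivOfEqBot ⊥ rfl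
  rw [← e.isRegular_congr, isRegular_quotient_iff, bot_sup_eq]

lemma RegularSeqMod.hasDepth {𝔪 : Ideal R} {rs : List R} :
    ∀ {I : Ideal R}, RegularSeqMod I rs → (∀ x ∈ rs, x ∈ 𝔪) → HasDepth 𝔪 rs.length I := by
  induction rs with
  | nil => intros; trivial
  | cons x xs ih =>
    intro I h hx
    exact ⟨x, hx x (by simp), h.1, ih h.2 fun y hy => hx y (by simp [hy])⟩

lemma HasDepth.of_succ {𝔪 : Ideal R} {m : ℕ} :
    ∀ {I : Ideal R}, HasDepth 𝔪 (m + 1) I → HasDepth 𝔪 m I := by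
  induction m with
  | zero => intros; trivial
  | succ m ih =>
    rintro I ⟨x, hx, hr, h⟩
    exact ⟨x, hx, hr, ih h⟩

lemma HasDepth.mono {𝔪 : Ideal R} {m n : ℕ} (h : m ≤ n) {I : Ideal R} (hI : HasDepth 𝔪 n I) :
    HasDepth 𝔪 m I := by
  induction n, h using Nat.le_induction with
  | base => exact hI
  | succ n _ ih => exact ih hI.of_succ

lemma hasDepth_one_iff {𝔪 I : Ideal R} : HasDepth 𝔪 1 I ↔ ∃ x ∈ 𝔪, RegularMod I x := by
  simp [HasDepth]

/-- The half of permutability of regular sequences that needs neither a local nor a graded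
hypothesis. -/
lemma RegularMod.swap {I : Ideal R} {x z : R} (hx : RegularMod I x)
    (hzx : RegularMod (I ⊔ Ideal.span {x}) z) : RegularMod (I ⊔ Ideal.span {z}) x := by
  intro w hw
  obtain ⟨i, hi, u, hu, h⟩ := Submodule.mem_sup.1 hw
  obtain ⟨u, rfl⟩ := Ideal.mem_span_singleton'.1 hu
  have h1 : u ∈ I ⊔ Ideal.span {x} := by
    refine hzx _ (Submodule.mem_sup.2 ⟨-i, I.neg_mem hi, w * x,
      Ideal.mem_span_singleton'.2 ⟨w, rfl⟩, ?_⟩)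
    linear_combination -h
  obtain ⟨j, hj, v, hv, rfl⟩ := Submodule.mem_sup.1 h1
  obtain ⟨v, rfl⟩ := Ideal.mem_span_singleton'.1 hv
  have h2 : w - v * z ∈ I := by
    refine hx _ ?_
    have : x * (w - v * z) = i + j * z := by linear_combination -h
    rw [this]
    exact I.add_mem hi (I.mul_mem_right _ hj)
  exact Submodule.mem_sup.2 ⟨_, h2, v * z, Ideal.mem_span_singleton'.2 ⟨v, rfl⟩, by ring⟩

section Noetherian

variable [IsNoetherianRing R]

lemma biUnion_associatedPrimes_quotient (I : Ideal R) :
    ⋃ p ∈ associatedPrimes R (R ⧸ I), (p : Set R) = {r : R | RegularMod I r}ᶜ := by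
  rw [biUnion_associatedPrimes_eq_compl_regular]
  simp only [isSMulRegular_quotient_iff_regularMod]

/-- The maximal ideal is not associated to `R ⧸ I` iff the socle of `R ⧸ I` is zero. -/
lemma hasDepth_one_iff_socle {𝔪 I : Ideal R} :
    HasDepth 𝔪 1 I ↔ ∀ z, (∀ a ∈ 𝔪, a * z ∈ I) → z ∈ I := by
  rw [hasDepth_one_iff]
  constructor
  · rintro ⟨x, hx, hr⟩ z hz
    exact hr z (hz x hx)
  · intro H
    by_contra! hcon
    have hfin := associatedPrimes.finite R (R ⧸ I)
    -- If `𝔪` consists of zero divisors, prime avoidance puts it inside one associated prime, the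
    -- annihilator of some class `z`; this `z` is a nonzero socle element. The two exceptional
    -- indices `⊤ ⊤` below are dummies, since all members are prime.
    have hsub : (𝔪 : Set R) ⊆ ⋃ p ∈ (hfin.toFinset : Set (Ideal R)), (p : Set R) := by
      rw [Set.Finite.coe_toFinset, biUnion_associatedPrimes_quotient]
      exact fun x hx => hcon x hx
    obtain ⟨p, hp, hle⟩ := (Ideal.subset_union_prime (f := fun p : Ideal R => p) ⊤ ⊤
      (fun p hp _ _ => IsAssociatedPrime.isPrime (hfin.mem_toFinset.1 hp))).1 hsub
    obtain ⟨hpp, y, hy⟩ := isAssociatedPrime_iff.1 (hfin.mem_toFinset.1 hp)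
    obtain ⟨z, rfl⟩ := Submodule.Quotient.mk_surjective _ y
    have hmem (a : R) : a ∈ p ↔ a * z ∈ I := by
      rw [hy, Submodule.mem_colon_singleton, Submodule.mem_bot, ← Submodule.Quotient.mk_smul,
        Submodule.Quotient.mk_eq_zero, smul_eq_mul]
    refine hpp.ne_top ((Ideal.eq_top_iff_one _).2 ((hmem 1).2 ?_))
    rw [one_mul]
    exact H z fun a ha => (hmem a).1 (hle ha)

/-- Writing `x z = i + w y` with `i ∈ I` turns a socle element `z` modulo `I + (y)` into a socle
element `w` modulo `I + (x)`; if `w` vanishes there, so does `z` modulo `I + (y)`. -/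
lemma HasDepth.sup_span_one {𝔪 I : Ideal R} {x y : R}
    (hx : RegularMod I x) (hy : RegularMod I y) (hxm : x ∈ 𝔪)
    (h : HasDepth 𝔪 1 (I ⊔ Ideal.span {x})) : HasDepth 𝔪 1 (I ⊔ Ideal.span {y}) := by
  rw [hasDepth_one_iff_socle] at h ⊢
  intro z hz
  obtain ⟨i, hi, u, hu, hxz⟩ := Submodule.mem_sup.1 (hz x hxm)
  obtain ⟨w, rfl⟩ := Ideal.mem_span_singleton'.1 hu
  have hw : w ∈ I ⊔ Ideal.span {x} := by
    refine h w fun a ha => ?_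
    obtain ⟨j, hj, v, hv, haz⟩ := Submodule.mem_sup.1 (hz a ha)
    obtain ⟨v, rfl⟩ := Ideal.mem_span_singleton'.1 hv
    have h2 : a * w - v * x ∈ I := by
      refine hy _ ?_
      have : y * (a * w - v * x) = x * j - a * i := by linear_combination a * hxz - x * haz
      rw [this]
      exact I.sub_mem (I.mul_mem_left _ hj) (I.mul_mem_left _ hi)
    exact Submodule.mem_sup.2 ⟨_, h2, v * x, Ideal.mem_span_singleton'.2 ⟨v, rfl⟩, by ring⟩
  obtain ⟨j, hj, v, hv, rfl⟩ := Submodule.mem_sup.1 hw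
  obtain ⟨v, rfl⟩ := Ideal.mem_span_singleton'.1 hv
  have h3 : z - v * y ∈ I := by
    refine hx _ ?_
    have : x * (z - v * y) = i + j * y := by linear_combination -hxz
    rw [this]
    exact I.add_mem hi (I.mul_mem_right _ hj)
  exact Submodule.mem_sup.2 ⟨_, h3, v * y, Ideal.mem_span_singleton'.2 ⟨v, rfl⟩, by ring⟩

end Noetherian

end RegularModulo

/-! ### Regular linear forms over an infinite field. -/

section LinearForms

variable {σ k : Type*} [Field k]

lemma isHomogeneous_mem_idealOfVars {x : MvPolynomial σ k} {c : ℕ} (hx : x.IsHomogeneous c)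
    (hc : 0 < c) : x ∈ idealOfVars σ k := by
  rw [← pow_one (idealOfVars σ k), mem_pow_idealOfVars_iff']
  exact fun d hd => hx.coeff_eq_zero (by omega)

lemma regularMod_span_X {s : Set σ} {i : σ} (hi : i ∉ s) :
    RegularMod (Ideal.span (X '' s) : Ideal (MvPolynomial σ k)) (X i) := by
  classical
  intro w hw
  rw [mem_ideal_span_X_image] at hw ⊢
  intro m hm
  obtain ⟨j, hj, hne⟩ := hw (Finsupp.single i 1 + m) (by
    rw [mem_support_iff, coeff_X_mul]
    exact mem_support_iff.1 hm)
  refine ⟨j, hj, ?_⟩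
  have : i ≠ j := fun h => hi (h ▸ hj)
  simpa [Finsupp.single_apply, this] using hne

/-- The set `t` of variables already killed is carried along so that the induction can move
variables from `s` to `t`; the case needed is `t = ∅`. -/
lemma hasDepth_span_X [DecidableEq σ] (m : ℕ) :
    ∀ s : Finset σ, s.card = m → ∀ t : Finset σ, Disjoint s t →
      HasDepth (idealOfVars σ k) m (Ideal.span (X '' (t : Set σ))) := by
  induction m with
  | zero => intros; trivial
  | succ m ih =>
    intro s hs t hst
    obtain ⟨i, hi⟩ := Finset.card_pos.1 (by omega : 0 < s.card)
    refine ⟨X i, Ideal.subset_span ⟨i, rfl⟩,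
      regularMod_span_X (by simpa using Finset.disjoint_left.1 hst hi), ?_⟩
    have := ih (s.erase i) (by rw [Finset.card_erase_of_mem hi, hs]; rfl) (insert i t) (by
      rw [Finset.disjoint_insert_right]
      exact ⟨Finset.notMem_erase _ _, hst.mono_left (Finset.erase_subset _ _)⟩)
    rwa [Finset.coe_insert, Set.image_insert_eq, Set.insert_eq, Ideal.span_union, sup_comm] at this

variable [Finite σ]

/-- Finitely many ideals of positive depth admit a common regular linear form. -/
lemma exists_linear_regularMod [Infinite k] {ι : Type*} [Finite ι]
    (I : ι → Ideal (MvPolynomial σ k)) (hI : ∀ i, HasDepth (idealOfVars σ k) 1 (I i)) :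
    ∃ z : MvPolynomial σ k, z.IsHomogeneous 1 ∧ ∀ i, RegularMod (I i) z := by
  by_contra! hcon
  have hfin (i : ι) : Finite (associatedPrimes (MvPolynomial σ k) (MvPolynomial σ k ⧸ I i)) :=
    associatedPrimes.finite _ _
  -- If every linear form is a zero divisor for some `I i`, the degree one part is a finite union of
  -- its intersections with associated primes. As `k` is infinite, one of these is everything, so
  -- that prime contains all variables, against positive depth.
  let p (q : Σ i, associatedPrimes (MvPolynomial σ k) (MvPolynomial σ k ⧸ I i)) :
      Subspace k (homogeneousSubmodule σ k 1) :=
    (q.2.1.restrictScalars k).comap (homogeneousSubmodule σ k 1).subtype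
  obtain ⟨⟨i, P, hP⟩, hq⟩ := Subspace.exists_eq_top_of_iUnion_eq_univ (p := p) <| by
    refine Set.eq_univ_of_forall fun z => ?_
    obtain ⟨i, hi⟩ := hcon z.1 z.2
    have : z.1 ∈ {r | RegularMod (I i) r}ᶜ := hi
    rw [← biUnion_associatedPrimes_quotient] at this
    obtain ⟨P, hP, hz⟩ := Set.mem_iUnion₂.1 this
    exact Set.mem_iUnion.2 ⟨⟨i, P, hP⟩, hz⟩
  have hle : idealOfVars σ k ≤ P := by
    refine Ideal.span_le.2 ?_
    rintro _ ⟨j, rfl⟩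
    have : (⟨X j, isHomogeneous_X k j⟩ : homogeneousSubmodule σ k 1) ∈ p ⟨i, P, hP⟩ := by
      rw [hq]; trivial
    exact this
  obtain ⟨x, hx, hr⟩ := hasDepth_one_iff.1 (hI i)
  have h1 : x ∈ ⋃ p ∈ associatedPrimes (MvPolynomial σ k) (MvPolynomial σ k ⧸ I i),
      (p : Set (MvPolynomial σ k)) := Set.mem_biUnion hP (hle hx)
  rw [biUnion_associatedPrimes_quotient] at h1
  exact h1 hr

/-- Depth drops by exactly one modulo any regular element. -/
lemma HasDepth.sup_span [Infinite k] {m : ℕ} :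
    ∀ {I : Ideal (MvPolynomial σ k)} {y : MvPolynomial σ k},
      HasDepth (idealOfVars σ k) (m + 1) I → RegularMod I y → y ∈ idealOfVars σ k →
      HasDepth (idealOfVars σ k) m (I ⊔ Ideal.span {y}) := by
  induction m with
  | zero => intros; trivial
  | succ m ih =>
    rintro I y ⟨x, hxm, hx, h⟩ hy hym
    have hx1 : HasDepth (idealOfVars σ k) 1 (I ⊔ Ideal.span {x}) := h.mono (by omega)
    have hy1 := HasDepth.sup_span_one hx hy hxm hx1
    -- A common regular form `z` mediates between `x` and `y`: the induction hypothesis passes from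
    -- `I + (x)` to `I + (x, z)`, hence bounds the depth of `I + (z)`, and then passes to `I + (z,
    -- y)`.
    obtain ⟨z, hz, hzr⟩ := exists_linear_regularMod
      ![I, I ⊔ Ideal.span {x}, I ⊔ Ideal.span {y}] (by
        intro i
        fin_cases i
        · exact hasDepth_one_iff.2 ⟨x, hxm, hx⟩
        · exact hx1
        · exact hy1)
    have hzm := isHomogeneous_mem_idealOfVars hz one_pos
    have hzx : RegularMod (I ⊔ Ideal.span {x}) z := hzr 1
    have hzy : RegularMod (I ⊔ Ideal.span {y}) z := hzr 2
    have h1 := ih h hzx hzm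
    rw [sup_right_comm] at h1
    have h2 : HasDepth (idealOfVars σ k) (m + 1) (I ⊔ Ideal.span {z}) :=
      ⟨x, hxm, hx.swap hzx, h1⟩
    have h3 := ih h2 (hy.swap hzy) hym
    rw [sup_right_comm] at h3
    exact ⟨z, hzm, hzy, h3⟩

/-- An ideal of depth at least `m` has a regular sequence of `m` linear forms. -/
lemma HasDepth.exists_linear_seq [Infinite k] {m : ℕ} :
    ∀ {I : Ideal (MvPolynomial σ k)}, HasDepth (idealOfVars σ k) m I →
      ∃ ls : List (MvPolynomial σ k), ls.length = m ∧ (∀ l ∈ ls, l.IsHomogeneous 1) ∧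
        RegularSeqMod I ls := by
  induction m with
  | zero => exact fun _ => ⟨[], rfl, by simp, trivial⟩
  | succ m ih =>
    intro I h
    obtain ⟨z, hz, hzr⟩ := exists_linear_regularMod (fun _ : Unit => I)
      fun _ => h.mono (by omega)
    obtain ⟨ls, h1, h2, h3⟩ := ih (h.sup_span (hzr ()) (isHomogeneous_mem_idealOfVars hz one_pos))
    exact ⟨z :: ls, by simp [h1], by simpa [hz] using h2, hzr (), h3⟩

variable (σ k) in
lemma hasDepth_bot : HasDepth (idealOfVars σ k) (Nat.card σ) ⊥ := by
  classical
  have := Fintype.ofFinite σ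
  have := hasDepth_span_X (σ := σ) (k := k) (Nat.card σ) Finset.univ (by simp) ∅ (by simp)
  simpa using this

end LinearForms

/-! ### Intersection and sum of two ideals modulo a regular element. -/

section Intersection

variable {R : Type*} [CommRing R]

/-- The sequence `0 → R/I₁ ⊓ I₂ → R/I₁ ⊕ R/I₂ → R/(I₁ + I₂) → 0` stays exact modulo `x`, because `x`
is regular on its last term. -/
lemma inf_sup_span_eq {I₁ I₂ : Ideal R} {x : R} (hx : RegularMod (I₁ ⊔ I₂) x) :
    (I₁ ⊔ Ideal.span {x}) ⊓ (I₂ ⊔ Ideal.span {x}) = I₁ ⊓ I₂ ⊔ Ideal.span {x} := by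
  refine le_antisymm ?_ (sup_le (inf_le_inf le_sup_left le_sup_left) (le_inf le_sup_right
    le_sup_right))
  rintro w ⟨h₁, h₂⟩
  obtain ⟨u₁, hu₁, v₁, hv₁, e₁⟩ := Submodule.mem_sup.1 h₁
  obtain ⟨u₂, hu₂, v₂, hv₂, e₂⟩ := Submodule.mem_sup.1 h₂
  obtain ⟨v₁, rfl⟩ := Ideal.mem_span_singleton'.1 hv₁
  obtain ⟨v₂, rfl⟩ := Ideal.mem_span_singleton'.1 hv₂
  have h : v₁ - v₂ ∈ I₁ ⊔ I₂ := by
    refine hx _ (Submodule.mem_sup.2 ⟨-u₁, I₁.neg_mem hu₁, u₂, hu₂, ?_⟩)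
    linear_combination e₂ - e₁
  obtain ⟨a, ha, b, hb, e⟩ := Submodule.mem_sup.1 h
  refine Submodule.mem_sup.2 ⟨u₁ + a * x, ⟨I₁.add_mem hu₁ (I₁.mul_mem_right _ ha), ?_⟩,
    (v₁ - a) * x, Ideal.mem_span_singleton'.2 ⟨_, rfl⟩, by linear_combination e₁⟩
  have : u₁ + a * x = u₂ - b * x := by linear_combination e₁ - e₂ + x * e
  rw [this]
  exact I₂.sub_mem hu₂ (I₂.mul_mem_right _ hb)

/-- If `R ⧸ I₁ ⊓ I₂` has depth at least two, then `R ⧸ I₁ ⊔ I₂` has positive depth. -/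
lemma hasDepth_one_sup [IsNoetherianRing R] {𝔪 I₁ I₂ : Ideal R} {x : R} (hx : x ∈ 𝔪)
    (hx₁ : RegularMod I₁ x) (h : HasDepth 𝔪 1 (I₁ ⊓ I₂ ⊔ Ideal.span {x}))
    (hx₂ : RegularMod I₂ x) : HasDepth 𝔪 1 (I₁ ⊔ I₂) := by
  rw [hasDepth_one_iff_socle] at h ⊢
  intro z hz
  -- The class of `u₂` modulo `I₁ ⊓ I₂ + (x)` is the snake-lemma image of `z`, which is killed by
  -- `x`. It is again a socle element, hence zero.
  obtain ⟨u₁, hu₁, u₂, hu₂, e⟩ := Submodule.mem_sup.1 (hz x hx)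
  have hu : u₂ ∈ I₁ ⊓ I₂ ⊔ Ideal.span {x} := by
    refine h u₂ fun a ha => ?_
    obtain ⟨v₁, hv₁, v₂, hv₂, e'⟩ := Submodule.mem_sup.1 (hz a ha)
    refine Submodule.mem_sup.2 ⟨a * u₂ - v₂ * x, ⟨?_, I₂.sub_mem (I₂.mul_mem_left _ hu₂)
      (I₂.mul_mem_right _ hv₂)⟩, v₂ * x, Ideal.mem_span_singleton'.2 ⟨_, rfl⟩, by ring⟩
    have : a * u₂ - v₂ * x = x * v₁ - a * u₁ := by linear_combination a * e - x * e'
    rw [this]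
    exact I₁.sub_mem (I₁.mul_mem_left _ hv₁) (I₁.mul_mem_left _ hu₁)
  obtain ⟨j, hj, w, hw, e'⟩ := Submodule.mem_sup.1 hu
  obtain ⟨w, rfl⟩ := Ideal.mem_span_singleton'.1 hw
  have hw₂ : w ∈ I₂ := by
    refine hx₂ _ ?_
    have : x * w = u₂ - j := by linear_combination e'
    rw [this]
    exact I₂.sub_mem hu₂ hj.2
  have hw₁ : z - w ∈ I₁ := by
    refine hx₁ _ ?_
    have : x * (z - w) = u₁ + j := by linear_combination -e - e'
    rw [this]
    exact I₁.add_mem hu₁ hj.1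
  exact Submodule.mem_sup.2 ⟨_, hw₁, w, hw₂, by ring⟩

end Intersection

/-! ### Graded Nakayama, descent along linear forms, and Krull's height bound. -/

section Forms

variable {σ k : Type*} [Field k]

attribute [local instance] MvPolynomial.gradedAlgebra

lemma isHomogeneous_span_form {x : MvPolynomial σ k} {c : ℕ} (hx : x.IsHomogeneous c) :
    (Ideal.span {x}).IsHomogeneous (homogeneousSubmodule σ k) := by
  refine Ideal.homogeneous_span _ _ ?_
  rintro _ rfl
  exact ⟨c, hx⟩

lemma coe_decompose_eq_homogeneousComponent (w : MvPolynomial σ k) (t : ℕ) :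
    (DirectSum.decompose (homogeneousSubmodule σ k) w t : MvPolynomial σ k) =
      homogeneousComponent t w :=
  decomposition.decompose'_apply w t

lemma homogeneousComponent_mul_form {x : MvPolynomial σ k} {c : ℕ} (hx : x.IsHomogeneous c)
    (w : MvPolynomial σ k) (t : ℕ) :
    homogeneousComponent (t + c) (w * x) = homogeneousComponent t w * x := by
  rw [← coe_decompose_eq_homogeneousComponent, ← coe_decompose_eq_homogeneousComponent]
  exact DirectSum.coe_decompose_mul_add_of_right_mem (homogeneousSubmodule σ k) hx

lemma homogeneousComponent_mul_form_of_lt {x : MvPolynomial σ k} {c : ℕ}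
    (hx : x.IsHomogeneous c) (w : MvPolynomial σ k) {t : ℕ} (h : t < c) :
    homogeneousComponent t (w * x) = 0 := by
  rw [← coe_decompose_eq_homogeneousComponent]
  exact DirectSum.coe_decompose_mul_of_right_mem_of_not_le (homogeneousSubmodule σ k) hx
    (not_le.2 h)

/-- Graded Nakayama for one form: if `f` is a multiple of `ℓ f` modulo `L`, then `f ∈ L`. -/
lemma mem_of_mul_one_sub_mem {L : Ideal (MvPolynomial σ k)}
    (hL : L.IsHomogeneous (homogeneousSubmodule σ k)) {f l c : MvPolynomial σ k} {d : ℕ}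
    (hf : f.IsHomogeneous d) (hl : l.IsHomogeneous 1) (h : f - c * (l * f) ∈ L) : f ∈ L := by
  have h1 := homogeneousComponent_mem_of_mem hL h d
  rwa [map_sub, homogeneousComponent_eq_self hf,
    homogeneousComponent_mul_form_of_lt (hl.mul hf) _ (by omega), sub_zero] at h1

/-- Membership of `f` in `L` may be tested after cutting down by suitable linear forms. The depth of
`L` is allowed to be one less than that of the other ideals, as happens for `L = I₁ + (g₂)`. -/
lemma exists_linear_seq_of_mem_imp [Infinite k] [Finite σ] {f : MvPolynomial σ k} {d : ℕ}
    (hf : f.IsHomogeneous d) {m : ℕ} :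
    ∀ {I₁ I₂ L : Ideal (MvPolynomial σ k)}, L.IsHomogeneous (homogeneousSubmodule σ k) →
      I₁ ⊔ I₂ = L ⊔ Ideal.span {f} → HasDepth (idealOfVars σ k) (m + 1) (I₁ ⊓ I₂) →
      HasDepth (idealOfVars σ k) (m + 1) I₁ → HasDepth (idealOfVars σ k) (m + 1) I₂ →
      HasDepth (idealOfVars σ k) m L →
      ∃ ls : List (MvPolynomial σ k), ls.length = m ∧ (∀ l ∈ ls, l.IsHomogeneous 1) ∧
        RegularSeqMod L ls ∧ (f ∈ L ⊔ Ideal.ofList ls → f ∈ L) := by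
  induction m with
  | zero => exact fun _ _ _ _ _ _ => ⟨[], rfl, by simp, trivial, by simp⟩
  | succ m ih =>
    intro I₁ I₂ L hL hsup hJ h₁ h₂ hLd
    obtain ⟨z, hz, hzr⟩ := exists_linear_regularMod ![I₁, I₂, I₁ ⊓ I₂] (by
      intro i
      fin_cases i
      exacts [h₁.mono (by omega), h₂.mono (by omega), hJ.mono (by omega)])
    have hzJ := hJ.sup_span (hzr 2) (isHomogeneous_mem_idealOfVars hz one_pos)
    have hsupd := hasDepth_one_sup (isHomogeneous_mem_idealOfVars hz one_pos) (hzr 0)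
      (hzJ.mono (by omega)) (hzr 1)
    obtain ⟨l, hl, hlr⟩ := exists_linear_regularMod ![I₁, I₂, I₁ ⊓ I₂, L, I₁ ⊔ I₂] (by
      intro i
      fin_cases i
      exacts [h₁.mono (by omega), h₂.mono (by omega), hJ.mono (by omega), hLd.mono (by omega),
        hsupd])
    have hlm := isHomogeneous_mem_idealOfVars hl one_pos
    have hlK : RegularMod (I₁ ⊔ I₂) l := hlr 4
    obtain ⟨ls, hlen, hlin, hreg, hmem⟩ := ih (I₁ := I₁ ⊔ Ideal.span {l})
      (I₂ := I₂ ⊔ Ideal.span {l}) (L := L ⊔ Ideal.span {l})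
      (hL.sup (isHomogeneous_span_form hl))
      (by rw [← sup_sup_distrib_right, hsup, sup_right_comm])
      (by rw [inf_sup_span_eq hlK]; exact hJ.sup_span (hlr 2) hlm)
      (h₁.sup_span (hlr 0) hlm) (h₂.sup_span (hlr 1) hlm) (hLd.sup_span (hlr 3) hlm)
    refine ⟨l :: ls, by simp [hlen], by simpa [hl] using hlin, ⟨hlr 3, hreg⟩, fun h => ?_⟩
    rw [Ideal.ofList_cons, ← sup_assoc] at h
    obtain ⟨u, hu, v, hv, e⟩ := Submodule.mem_sup.1 (hmem h)
    obtain ⟨w, rfl⟩ := Ideal.mem_span_singleton'.1 hv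
    -- From `f = u + w l` one gets `l w ∈ L + (f) = I₁ + I₂`. Cancelling `l` gives `w = u' + c f`,
    -- so `f` agrees with `c l f` modulo `L`.
    have hw : w ∈ L ⊔ Ideal.span {f} := by
      rw [← hsup]
      refine hlK _ ?_
      rw [hsup]
      exact Submodule.mem_sup.2 ⟨-u, L.neg_mem hu, f, Ideal.mem_span_singleton_self f,
        by linear_combination -e⟩
    obtain ⟨u', hu', v', hv', rfl⟩ := Submodule.mem_sup.1 hw
    obtain ⟨c, rfl⟩ := Ideal.mem_span_singleton'.1 hv'
    refine mem_of_mul_one_sub_mem (c := c) hL hf hl ?_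
    have : f - c * (l * f) = u + l * u' := by linear_combination -e
    rw [this]
    exact L.add_mem hu (L.mul_mem_left _ hu')

/-- The prime ideal generated by the variables indexed by `s`. -/
noncomputable def coordinatePrime (σ k : Type*) [Field k] (s : Set σ) :
    Ideal (MvPolynomial σ k) :=
  RingHom.ker (aeval (R := k) (sᶜ.indicator X : σ → MvPolynomial σ k)).toRingHom

instance (s : Set σ) : (coordinatePrime σ k s).IsPrime := by
  unfold coordinatePrime
  exact RingHom.ker_isPrime _

lemma mem_coordinatePrime_iff {s : Set σ} {p : MvPolynomial σ k} :
    p ∈ coordinatePrime σ k s ↔ aeval (R := k) (sᶜ.indicator X : σ → MvPolynomial σ k) p = 0 :=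
  Iff.rfl

lemma coordinatePrime_lt_insert {s : Set σ} {i : σ} (hi : i ∉ s) :
    coordinatePrime σ k s < coordinatePrime σ k (insert i s) := by
  classical
  refine lt_of_le_of_ne ?_ fun h => ?_
  · intro p hp
    rw [mem_coordinatePrime_iff] at hp ⊢
    have : aeval (R := k) ((insert i s)ᶜ.indicator X : σ → MvPolynomial σ k) =
        (aeval (R := k) ((insert i s)ᶜ.indicator X : σ → MvPolynomial σ k)).comp
        (aeval (R := k) (sᶜ.indicator X : σ → MvPolynomial σ k)) := by
      ext j : 1
      by_cases hj : j ∈ s <;> simp [hj]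
    rw [this, AlgHom.comp_apply, hp, map_zero]
  · have : X i ∈ coordinatePrime σ k s := by
      rw [h]
      simp [mem_coordinatePrime_iff]
    simp [mem_coordinatePrime_iff, hi] at this

lemma card_le_height_coordinatePrime [Finite σ] (s : Finset σ) :
    (s.card : ℕ∞) ≤ (coordinatePrime σ k s).height := by
  classical
  induction s using Finset.induction with
  | empty => simp
  | insert i s hi ih =>
    rw [Finset.card_insert_of_notMem hi, Finset.coe_insert]
    push_cast
    exact (add_le_add_left ih 1).trans (Ideal.height_add_one_le_of_lt_of_isPrime
      (coordinatePrime_lt_insert (by simpa using hi)))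

/-- Krull's bound for the dimension of the quotient by two non-constant forms. -/
lemma card_le_ringKrullDim_quotient_add_two [Finite σ] {f g : MvPolynomial σ k}
    (hf : f ∈ idealOfVars σ k) (hg : g ∈ idealOfVars σ k) :
    (Nat.card σ : WithBot ℕ∞) ≤ ringKrullDim (MvPolynomial σ k ⧸ Ideal.span {f, g}) + 2 := by
  have := Fintype.ofFinite σ
  have hle : idealOfVars σ k ≤ coordinatePrime σ k (Finset.univ : Finset σ) := by
    refine Ideal.span_le.2 ?_
    rintro _ ⟨i, rfl⟩
    simp [mem_coordinatePrime_iff]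
  have h1 := card_le_height_coordinatePrime (k := k) (Finset.univ : Finset σ)
  have h2 := Ideal.height_le_ringKrullDim_quotient_add_encard
    (p := coordinatePrime σ k (Finset.univ : Finset σ)) {f, g} (by
      rintro _ (rfl | rfl)
      exacts [hle hf, hle hg])
  have h3 : ({f, g} : Set (MvPolynomial σ k)).encard ≤ 2 := Set.encard_insert_le _ _ |>.trans (by
    rw [Set.encard_singleton]; norm_num)
  rw [Finset.card_univ, ← Nat.card_eq_fintype_card] at h1
  calc (Nat.card σ : WithBot ℕ∞) ≤ _ := by exact_mod_cast h1
    _ ≤ _ := h2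
    _ ≤ _ := add_le_add_right (WithBot.coe_le_coe.2 h3) _

end Forms

/-! ### Hilbert functions and Hilbert series. -/

section HilbertSeries

lemma finrank_map_add_finrank_inf_ker {K V W : Type*} [Field K] [AddCommGroup V] [Module K V]
    [AddCommGroup W] [Module K W] (f : V →ₗ[K] W) (U : Submodule K V) [FiniteDimensional K U] :
    Module.finrank K (U.map f) + Module.finrank K (U ⊓ LinearMap.ker f : Submodule K V) =
      Module.finrank K U := by
  have h := (f.domRestrict U).finrank_range_add_finrank_ker
  rw [LinearMap.range_domRestrict, LinearMap.ker_domRestrict] at h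
  rw [← h, ← Submodule.map_comap_subtype U, Submodule.finrank_map_subtype_eq]

variable {σ k : Type*} [Field k]

attribute [local instance] MvPolynomial.gradedAlgebra

instance finiteDimensional_homogeneousSubmodule [Finite σ] (t : ℕ) :
    FiniteDimensional k (homogeneousSubmodule σ k t) :=
  Module.Finite.iff_fg.2 (homogeneousSubmodule_fg σ k t)

lemma hilbertFunction_natCast (I : Ideal (MvPolynomial σ k)) (t : ℕ) :
    hilbertFunction I t = Module.finrank k
      ((homogeneousSubmodule σ k t).map (Ideal.Quotient.mkₐ k I).toLinearMap) := by
  simp [hilbertFunction]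

lemma hilbertFunction_of_neg (I : Ideal (MvPolynomial σ k)) {t : ℤ} (ht : t < 0) :
    hilbertFunction I t = 0 := if_pos ht

lemma ker_mkₐ (I : Ideal (MvPolynomial σ k)) :
    LinearMap.ker (Ideal.Quotient.mkₐ k I).toLinearMap = I.restrictScalars k := by
  ext x
  simp [Ideal.Quotient.eq_zero_iff_mem]

lemma isHomogeneous_span_X (s : Set σ) :
    (Ideal.span (X '' s) : Ideal (MvPolynomial σ k)).IsHomogeneous (homogeneousSubmodule σ k) := by
  refine Ideal.homogeneous_span _ _ ?_
  rintro _ ⟨i, -, rfl⟩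
  exact ⟨1, isHomogeneous_X k i⟩

lemma one_notMem_idealOfVars : (1 : MvPolynomial σ k) ∉ idealOfVars σ k := by
  have := (C_mem_pow_idealOfVars_iff (σ := σ) (R := k) 1 1).not.2 (by simp)
  simpa using this

lemma idealOfVars_ne_top : idealOfVars σ k ≠ ⊤ :=
  (Ideal.ne_top_iff_one _).2 one_notMem_idealOfVars

variable [Finite σ]

lemma hilbertFunction_add_finrank (I : Ideal (MvPolynomial σ k)) (t : ℕ) :
    hilbertFunction I t +
      Module.finrank k (homogeneousSubmodule σ k t ⊓ I.restrictScalars k : Submodule k _) =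
      Module.finrank k (homogeneousSubmodule σ k t) := by
  rw [hilbertFunction_natCast, ← ker_mkₐ, finrank_map_add_finrank_inf_ker]

lemma hilbertFunction_sup_span_of_lt {I : Ideal (MvPolynomial σ k)}
    (hI : I.IsHomogeneous (homogeneousSubmodule σ k)) {x : MvPolynomial σ k} {c : ℕ}
    (hx : x.IsHomogeneous c) {t : ℕ} (ht : t < c) :
    hilbertFunction (I ⊔ Ideal.span {x}) t = hilbertFunction I t := by
  have h1 := hilbertFunction_add_finrank I t
  have h2 := hilbertFunction_add_finrank (I ⊔ Ideal.span {x}) t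
  have : (homogeneousSubmodule σ k t ⊓ (I ⊔ Ideal.span {x}).restrictScalars k : Submodule k _) =
      homogeneousSubmodule σ k t ⊓ I.restrictScalars k := by
    refine le_antisymm ?_ (inf_le_inf_left _ (Submodule.restrictScalars_mono k le_sup_left))
    rintro w ⟨hw, hw'⟩
    refine ⟨hw, ?_⟩
    obtain ⟨u, hu, v, hv, e⟩ := Submodule.mem_sup.1 hw'
    obtain ⟨v, rfl⟩ := Ideal.mem_span_singleton'.1 hv
    have h := homogeneousComponent_mem_of_mem hI hu t
    have he := congrArg (homogeneousComponent t) e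
    rw [map_add, homogeneousComponent_mul_form_of_lt hx _ ht, add_zero,
      homogeneousComponent_eq_self hw] at he
    rwa [he] at h
  rw [this] at h2
  omega

/-- Dimension count for `0 → (R/I')(-c) → R/I → R/(I + (x)) → 0`, where `I' = I : x` and the first
map is multiplication by `x`. -/
lemma hilbertFunction_sup_span_add {I I' : Ideal (MvPolynomial σ k)}
    (hI : I.IsHomogeneous (homogeneousSubmodule σ k)) {x : MvPolynomial σ k} {c : ℕ}
    (hx : x.IsHomogeneous c) (hI' : ∀ w, w ∈ I' ↔ x * w ∈ I) (t : ℕ) :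
    hilbertFunction (I ⊔ Ideal.span {x}) (t + c : ℕ) + hilbertFunction I' t =
      hilbertFunction I (t + c : ℕ) := by
  have h1 := hilbertFunction_add_finrank I (t + c)
  have h2 := hilbertFunction_add_finrank (I ⊔ Ideal.span {x}) (t + c)
  have h3 := hilbertFunction_add_finrank I' t
  set V := homogeneousSubmodule σ k t
  set U := homogeneousSubmodule σ k (t + c)
  set W := V.map (LinearMap.mulRight k x)
  have hWU : W ≤ U := by
    rintro _ ⟨w, hw, rfl⟩
    exact IsHomogeneous.mul hw hx
  have h4 := finrank_map_add_finrank_inf_ker (Ideal.Quotient.mkₐ k I).toLinearMap W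
  have h5 := finrank_map_add_finrank_inf_ker
    ((Ideal.Quotient.mkₐ k I).toLinearMap ∘ₗ LinearMap.mulRight k x) V
  have e1 : LinearMap.ker ((Ideal.Quotient.mkₐ k I).toLinearMap ∘ₗ LinearMap.mulRight k x) =
      I'.restrictScalars k := by
    rw [LinearMap.ker_comp, ker_mkₐ]
    ext w
    simp [hI', mul_comm]
  have e2 : U ⊓ (I ⊔ Ideal.span {x}).restrictScalars k = (U ⊓ I.restrictScalars k) ⊔ W := by
    refine le_antisymm ?_ (sup_le (inf_le_inf_left _ (Submodule.restrictScalars_mono k le_sup_left))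
      (le_inf hWU ?_))
    · rintro w ⟨hw, hw'⟩
      obtain ⟨u, hu, v, hv, e⟩ := Submodule.mem_sup.1 hw'
      obtain ⟨v, rfl⟩ := Ideal.mem_span_singleton'.1 hv
      have he := congrArg (homogeneousComponent (t + c)) e
      rw [map_add, homogeneousComponent_mul_form hx, homogeneousComponent_eq_self hw] at he
      exact Submodule.mem_sup.2 ⟨_, ⟨homogeneousComponent_isHomogeneous _ _,
        homogeneousComponent_mem_of_mem hI hu _⟩, _,
        ⟨_, homogeneousComponent_isHomogeneous t v, rfl⟩, he⟩
    · rintro _ ⟨w, -, rfl⟩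
      exact Submodule.mem_sup_right (Ideal.mem_span_singleton'.2 ⟨w, rfl⟩)
  have h6 := Submodule.finrank_sup_add_finrank_inf_eq (U ⊓ I.restrictScalars k) W
  have e3 : U ⊓ I.restrictScalars k ⊓ W = W ⊓ I.restrictScalars k := by
    rw [inf_right_comm, inf_eq_right.2 hWU]
  rw [Submodule.map_comp, e1] at h5
  change Module.finrank k (Submodule.map _ W) + _ = _ at h5
  rw [ker_mkₐ] at h4
  rw [e2] at h2
  rw [e3] at h6
  omega

/-- The Hilbert series of the quotient by a homogeneous ideal. -/
noncomputable def hilbertSeries (I : Ideal (MvPolynomial σ k)) : PowerSeries ℤ :=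
  PowerSeries.mk fun t => (hilbertFunction I t : ℤ)

lemma hilbertSeries_eq_add {I I' : Ideal (MvPolynomial σ k)}
    (hI : I.IsHomogeneous (homogeneousSubmodule σ k)) {x : MvPolynomial σ k} {c : ℕ}
    (hx : x.IsHomogeneous c) (hI' : ∀ w, w ∈ I' ↔ x * w ∈ I) :
    hilbertSeries I = hilbertSeries (I ⊔ Ideal.span {x}) +
      PowerSeries.X ^ c * hilbertSeries I' := by
  ext t
  rw [map_add, PowerSeries.coeff_X_pow_mul']
  simp only [hilbertSeries, PowerSeries.coeff_mk]
  split_ifs with h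
  · obtain ⟨s, rfl⟩ := Nat.exists_eq_add_of_le' h
    rw [Nat.add_sub_cancel, ← hilbertFunction_sup_span_add hI hx hI']
    push_cast
    rfl
  · rw [hilbertFunction_sup_span_of_lt hI hx (not_le.1 h), add_zero]

lemma hilbertSeries_sup_span {I : Ideal (MvPolynomial σ k)}
    (hI : I.IsHomogeneous (homogeneousSubmodule σ k)) {x : MvPolynomial σ k} {c : ℕ}
    (hx : x.IsHomogeneous c) (h : RegularMod I x) :
    hilbertSeries (I ⊔ Ideal.span {x}) = (1 - PowerSeries.X ^ c) * hilbertSeries I := by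
  have := hilbertSeries_eq_add hI hx (I' := I) fun w => ⟨fun hw => I.mul_mem_left _ hw, h w⟩
  linear_combination -this

lemma hilbertSeries_sup_ofList {ls : List (MvPolynomial σ k)} :
    ∀ {I : Ideal (MvPolynomial σ k)}, I.IsHomogeneous (homogeneousSubmodule σ k) →
      (∀ l ∈ ls, l.IsHomogeneous 1) → RegularSeqMod I ls →
      hilbertSeries (I ⊔ Ideal.ofList ls) = (1 - PowerSeries.X) ^ ls.length * hilbertSeries I := by
  induction ls with
  | nil => intros; simp
  | cons l ls ih =>
    intro I hI hl h
    have hl1 := hl l (by simp)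
    rw [Ideal.ofList_cons, ← sup_assoc, ih (hI.sup (isHomogeneous_span_form hl1))
      (fun x hx => hl x (by simp [hx])) h.2, hilbertSeries_sup_span hI hl1 h.1, pow_one,
      List.length_cons]
    ring

/-- Killing all variables one by one leaves the field, which yields the series of the polynomial
ring without counting monomials. -/
lemma hilbertSeries_span_X (s : Finset σ) :
    hilbertSeries (Ideal.span (X '' (s : Set σ)) : Ideal (MvPolynomial σ k)) =
      (1 - PowerSeries.X) ^ s.card * hilbertSeries (⊥ : Ideal (MvPolynomial σ k)) := by
  classical
  induction s using Finset.induction with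
  | empty => simp
  | insert i s hi ih =>
    rw [Finset.coe_insert, Set.image_insert_eq, Set.insert_eq, Ideal.span_union, sup_comm,
      hilbertSeries_sup_span (isHomogeneous_span_X _) (isHomogeneous_X k i)
        (regularMod_span_X (by simpa using hi)), ih, Finset.card_insert_of_notMem hi]
    ring

lemma hilbertFunction_eq_zero_iff (I : Ideal (MvPolynomial σ k)) (t : ℕ) :
    hilbertFunction I t = 0 ↔ ∀ w : MvPolynomial σ k, w.IsHomogeneous t → w ∈ I := by
  rw [hilbertFunction_natCast, Submodule.finrank_eq_zero, ← le_bot_iff,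
    Submodule.map_le_iff_le_comap, Submodule.comap_bot, ker_mkₐ]
  rfl

lemma hilbertFunction_zero_of_ne_top {I : Ideal (MvPolynomial σ k)} (hI : I ≠ ⊤) :
    hilbertFunction I 0 ≠ 0 := by
  have := hilbertFunction_eq_zero_iff I 0
  rw [Nat.cast_zero] at this
  rw [Ne, this]
  intro h
  exact hI ((Ideal.eq_top_iff_one I).2 (h 1 (isHomogeneous_one σ k)))

lemma hilbertSeries_idealOfVars : hilbertSeries (idealOfVars σ k) = 1 := by
  ext t
  rw [hilbertSeries, PowerSeries.coeff_mk, PowerSeries.coeff_one]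
  split_ifs with h
  · subst h
    have h1 := hilbertFunction_zero_of_ne_top (idealOfVars_ne_top (σ := σ) (k := k))
    have h2 := hilbertFunction_add_finrank (idealOfVars σ k) 0
    have h3 : Module.finrank k (homogeneousSubmodule σ k 0) = 1 := by
      rw [homogeneousSubmodule_zero, Submodule.one_eq_span, finrank_span_singleton one_ne_zero]
    rw [Nat.cast_zero] at *
    norm_cast
    omega
  · rw [Nat.cast_eq_zero, hilbertFunction_eq_zero_iff]
    exact fun w hw => isHomogeneous_mem_idealOfVars hw (Nat.pos_of_ne_zero h)

/-- The Hilbert series of a polynomial ring. -/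
lemma one_sub_X_pow_mul_hilbertSeries_bot :
    (1 - PowerSeries.X) ^ Nat.card σ * hilbertSeries (⊥ : Ideal (MvPolynomial σ k)) = 1 := by
  have := Fintype.ofFinite σ
  have h := hilbertSeries_span_X (k := k) (Finset.univ : Finset σ)
  rw [Finset.card_univ, ← Nat.card_eq_fintype_card, Finset.coe_univ, Set.image_univ,
    hilbertSeries_idealOfVars] at h
  exact h.symm

end HilbertSeries

/-! ### Geometric sums and the order of vanishing at `1`. -/

section GeometricSum

/-- The polynomial `1 + X + ⋯ + X ^ (c - 1)`. -/
noncomputable def geomPoly (c : ℕ) : Polynomial ℤ := ∑ i ∈ Finset.range c, Polynomial.X ^ i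

lemma one_sub_X_mul_geomPoly (c : ℕ) :
    (1 - PowerSeries.X) * (geomPoly c : PowerSeries ℤ) = 1 - PowerSeries.X ^ c := by
  have h : (1 - Polynomial.X) * geomPoly c = 1 - Polynomial.X ^ c := mul_neg_geom_sum _ _
  simpa using congrArg (Polynomial.toPowerSeries (R := ℤ)) h

lemma eval_one_geomPoly (c : ℕ) : (geomPoly c).eval 1 = c := by
  simp [geomPoly, Polynomial.eval_finsetSum]

lemma natDegree_geomPoly_le (c : ℕ) : (geomPoly c).natDegree ≤ c - 1 := by
  refine Polynomial.natDegree_sum_le_of_forall_le _ _ fun i hi => ?_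
  rw [Polynomial.natDegree_X_pow]
  have := Finset.mem_range.1 hi
  omega

lemma coeff_geomPoly (c t : ℕ) : (geomPoly c).coeff t = if t < c then 1 else 0 := by
  simp [geomPoly, Polynomial.coeff_X_pow]

lemma one_sub_X_ne_zero : (1 - PowerSeries.X : PowerSeries ℤ) ≠ 0 := by
  intro h
  simpa using congrArg (PowerSeries.coeff (R := ℤ) 0) h

lemma eq_of_one_sub_X_pow_mul_eq {a b : ℕ} {P Q : Polynomial ℤ} (hP : P.eval 1 ≠ 0)
    (hQ : Q.eval 1 ≠ 0) (h : (1 - Polynomial.X) ^ a * P = (1 - Polynomial.X) ^ b * Q) :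
    a = b := by
  have h0 : (1 - Polynomial.X : Polynomial ℤ) ≠ 0 := by
    intro h
    simpa using congrArg (Polynomial.eval 0) h
  wlog hab : a ≤ b generalizing a b P Q
  · exact (this hQ hP h.symm (by omega)).symm
  obtain ⟨c, rfl⟩ := Nat.exists_eq_add_of_le hab
  rw [pow_add, mul_assoc] at h
  have h1 := mul_left_cancel₀ (pow_ne_zero _ h0) h
  by_contra hc
  have hc' : c ≠ 0 := by omega
  exact hP (by rw [h1]; simp [hc'])

end GeometricSum

/-! ### Artinian reductions and their Hilbert series. -/

section Artinian

variable {σ k : Type*} [Field k]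

attribute [local instance] MvPolynomial.gradedAlgebra

lemma isHomogeneous_sup_ofList {I : Ideal (MvPolynomial σ k)}
    (hI : I.IsHomogeneous (homogeneousSubmodule σ k)) {ls : List (MvPolynomial σ k)}
    (hls : ∀ l ∈ ls, l.IsHomogeneous 1) :
    (I ⊔ Ideal.ofList ls).IsHomogeneous (homogeneousSubmodule σ k) :=
  hI.sup (Ideal.homogeneous_span _ _ fun l hl => ⟨1, hls l hl⟩)

lemma sup_ofList_le_idealOfVars {I : Ideal (MvPolynomial σ k)} (hI : I ≤ idealOfVars σ k)
    {ls : List (MvPolynomial σ k)} (hls : ∀ l ∈ ls, l.IsHomogeneous 1) :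
    I ⊔ Ideal.ofList ls ≤ idealOfVars σ k :=
  sup_le hI (Ideal.span_le.2 fun l hl => isHomogeneous_mem_idealOfVars (hls l hl) one_pos)

lemma isHomogeneous_span_pair {f g : MvPolynomial σ k} {d e : ℕ}
    (hf : f.IsHomogeneous d) (hg : g.IsHomogeneous e) :
    (Ideal.span {f, g}).IsHomogeneous (homogeneousSubmodule σ k) := by
  rw [Ideal.span_insert]
  exact (isHomogeneous_span_form hf).sup (isHomogeneous_span_form hg)

variable [Finite σ]

/-- The images of the powers of the irrelevant ideal stabilise. From then on a form of degree `t` is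
congruent modulo `J` to a polynomial of order above `t`, and comparing components of degree `t` puts
it in `J`. -/
lemma hilbertFunction_eventually_zero {J : Ideal (MvPolynomial σ k)}
    (hJ : J.IsHomogeneous (homogeneousSubmodule σ k)) [IsArtinianRing (MvPolynomial σ k ⧸ J)] :
    ∃ N : ℕ, ∀ t ≥ N, hilbertFunction J (t : ℕ) = 0 := by
  let F : ℕ →o (Submodule (MvPolynomial σ k ⧸ J) (MvPolynomial σ k ⧸ J))ᵒᵈ :=
    ⟨fun i => OrderDual.toDual ((idealOfVars σ k ^ i).map (Ideal.Quotient.mk J)),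
      fun i j hij => Ideal.map_mono (Ideal.pow_le_pow_right hij)⟩
  obtain ⟨N, hN⟩ := IsArtinian.monotone_stabilizes F
  refine ⟨N, fun t ht => ?_⟩
  rw [hilbertFunction_eq_zero_iff]
  intro w hw
  have h1 : w ∈ idealOfVars σ k ^ t := by
    rw [mem_pow_idealOfVars_iff']
    exact fun d hd => hw.coeff_eq_zero (by omega)
  have h2 : (idealOfVars σ k ^ t).map (Ideal.Quotient.mk J) =
      (idealOfVars σ k ^ (t + 1)).map (Ideal.Quotient.mk J) :=
    (hN t ht).symm.trans (hN (t + 1) (by omega))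
  have h3 := Ideal.mem_map_of_mem (Ideal.Quotient.mk J) h1
  rw [h2, ← Ideal.mem_comap, Ideal.comap_map_of_surjective' _ Ideal.Quotient.mk_surjective,
    Ideal.mk_ker] at h3
  obtain ⟨u, hu, j, hj, e⟩ := Submodule.mem_sup.1 h3
  have h4 : homogeneousComponent t u = 0 := by
    ext d
    rw [coeff_homogeneousComponent, coeff_zero]
    split_ifs with hd
    · exact (mem_pow_idealOfVars_iff' _ _).1 hu d (by omega)
    · rfl
  have h5 := congrArg (homogeneousComponent t) e
  rw [map_add, h4, zero_add, homogeneousComponent_eq_self hw] at h5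
  rw [← h5]
  exact homogeneousComponent_mem_of_mem hJ hj t

lemma isArtinianRing_of_hilbertFunction_eventually_zero {J : Ideal (MvPolynomial σ k)} {N : ℕ}
    (h : ∀ t ≥ N, hilbertFunction J (t : ℕ) = 0) : IsArtinianRing (MvPolynomial σ k ⧸ J) := by
  have hfin : Module.Finite k (MvPolynomial σ k ⧸ J) := by
    let V : Submodule k (MvPolynomial σ k) := ⨆ t : Fin N, homogeneousSubmodule σ k t
    have hV : V.FG := Submodule.fg_iSup _ fun t => homogeneousSubmodule_fg σ k t
    have htop : V.map (Ideal.Quotient.mkₐ k J).toLinearMap = ⊤ := by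
      refine eq_top_iff.2 fun y _ => ?_
      obtain ⟨p, rfl⟩ := Ideal.Quotient.mk_surjective y
      rw [← sum_homogeneousComponent p, map_sum]
      refine Submodule.sum_mem _ fun i _ => ?_
      by_cases hi : i < N
      · exact ⟨_, Submodule.mem_iSup_of_mem (⟨i, hi⟩ : Fin N)
          (homogeneousComponent_isHomogeneous i p), rfl⟩
      · rw [Ideal.Quotient.eq_zero_iff_mem.2 ((hilbertFunction_eq_zero_iff J i).1
          (h i (not_lt.1 hi)) _ (homogeneousComponent_isHomogeneous i p))]
        exact Submodule.zero_mem _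
    exact ⟨htop ▸ hV.map _⟩
  exact IsArtinianRing.of_finite k _

lemma exists_hilbertSeries_eq_coe {J : Ideal (MvPolynomial σ k)} (hJ : J ≠ ⊤) {N : ℕ}
    (h : ∀ t ≥ N, hilbertFunction J (t : ℕ) = 0) :
    ∃ P : Polynomial ℤ, hilbertSeries J = P ∧ P.eval 1 ≠ 0 := by
  refine ⟨∑ t ∈ Finset.range N, Polynomial.monomial t (hilbertFunction J t : ℤ), ?_, ?_⟩
  · ext t
    rw [Polynomial.coeff_coe, Polynomial.finsetSum_coeff, hilbertSeries, PowerSeries.coeff_mk]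
    simp only [Polynomial.coeff_monomial, Finset.sum_ite_eq', Finset.mem_range]
    split_ifs with ht
    · rfl
    · rw [h t (not_lt.1 ht), Nat.cast_zero]
  · rw [Polynomial.eval_finsetSum]
    simp only [Polynomial.eval_monomial, one_pow, mul_one]
    have h0 := hilbertFunction_zero_of_ne_top hJ
    have hN : 0 < N := by
      by_contra hN
      exact h0 (by simpa using h 0 (by omega))
    refine (Finset.sum_pos' (fun i _ => by positivity) ⟨0, Finset.mem_range.2 hN, ?_⟩).ne'
    rw [Nat.cast_zero]
    exact_mod_cast Nat.pos_of_ne_zero h0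

/-- The Hilbert series of an Artinian reduction of an ideal of codimension two. -/
lemma IsArtinianReduction.hilbertSeries_eq {I : Ideal (MvPolynomial σ k)}
    (hI : I.IsHomogeneous (homogeneousSubmodule σ k)) {q : Polynomial ℤ} {c : ℕ}
    (hq : q.eval 1 ≠ 0)
    (h : (1 - PowerSeries.X : PowerSeries ℤ) ^ Nat.card σ * hilbertSeries I =
      (1 - PowerSeries.X) ^ c * (q : PowerSeries ℤ))
    {ls : List (MvPolynomial σ k)} (hls : IsArtinianReduction I ls) :
    hilbertSeries (I ⊔ Ideal.ofList ls) = (q : PowerSeries ℤ) := by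
  obtain ⟨hreg, hne⟩ := (isRegular_quotient_iff I ls).1 hls.regular
  have := hls.artinian
  obtain ⟨N, hN⟩ := hilbertFunction_eventually_zero (isHomogeneous_sup_ofList hI hls.linear)
  obtain ⟨P, hP, hP1⟩ := exists_hilbertSeries_eq_coe hne hN
  have h1 := hilbertSeries_sup_ofList hI hls.linear hreg
  have h2 : (1 - PowerSeries.X : PowerSeries ℤ) ^ Nat.card σ * (P : PowerSeries ℤ) =
      (1 - PowerSeries.X) ^ (ls.length + c) * (q : PowerSeries ℤ) := by
    rw [pow_add, ← hP, h1]
    linear_combination (1 - PowerSeries.X) ^ ls.length * h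
  have h3 : (1 - Polynomial.X : Polynomial ℤ) ^ Nat.card σ * P =
      (1 - Polynomial.X) ^ (ls.length + c) * q := by
    apply Polynomial.coe_injective ℤ
    simpa using h2
  -- Both `P` and `q` are nonzero at `1`, so the number of linear forms in the reduction is forced
  -- and the powers of `1 - X` cancel.
  rw [eq_of_one_sub_X_pow_mul_eq hP1 hq h3] at h2
  rw [hP]
  exact mul_left_cancel₀ (pow_ne_zero _ one_sub_X_ne_zero) h2

/-- After `m` regular linear forms the series is the polynomial `q`, so the quotient is
finite-dimensional over `k`. -/
lemma exists_isArtinianReduction [Infinite k] {I : Ideal (MvPolynomial σ k)}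
    (hI : I.IsHomogeneous (homogeneousSubmodule σ k)) (hle : I ≤ idealOfVars σ k)
    {q : Polynomial ℤ} {c m : ℕ} (hm : m + c = Nat.card σ)
    (h : (1 - PowerSeries.X : PowerSeries ℤ) ^ Nat.card σ * hilbertSeries I =
      (1 - PowerSeries.X) ^ c * (q : PowerSeries ℤ))
    (hd : HasDepth (idealOfVars σ k) m I) : ∃ ls, IsArtinianReduction I ls := by
  obtain ⟨ls, hlen, hlin, hreg⟩ := hd.exists_linear_seq
  refine ⟨ls, hlin, (isRegular_quotient_iff I ls).2 ⟨hreg, ?_⟩, ?_⟩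
  · exact ne_top_of_le_ne_top idealOfVars_ne_top (sup_ofList_le_idealOfVars hle hlin)
  · have h1 := hilbertSeries_sup_ofList hI hlin hreg
    have h2 : hilbertSeries (I ⊔ Ideal.ofList ls) = (q : PowerSeries ℤ) := by
      refine mul_left_cancel₀ (pow_ne_zero c one_sub_X_ne_zero) ?_
      rw [← h, ← hm, h1, hlen]
      ring
    refine isArtinianRing_of_hilbertFunction_eventually_zero (N := q.natDegree + 1) fun t ht => ?_
    have h3 := congrArg (PowerSeries.coeff t) h2
    rw [hilbertSeries, PowerSeries.coeff_mk, Polynomial.coeff_coe,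
      Polynomial.coeff_eq_zero_of_natDegree_lt (by omega)] at h3
    exact_mod_cast h3

lemma hilbertSeries_span_pair {f g : MvPolynomial σ k} {d e : ℕ}
    (hf : f.IsHomogeneous d) (hg : g.IsHomogeneous e) (h : RegularSeqMod ⊥ [f, g]) :
    (1 - PowerSeries.X : PowerSeries ℤ) ^ Nat.card σ * hilbertSeries (Ideal.span {f, g}) =
      (1 - PowerSeries.X) ^ 2 * ((geomPoly d * geomPoly e : Polynomial ℤ) : PowerSeries ℤ) := by
  have h1 : RegularMod ⊥ f := h.1
  have h2 : RegularMod (⊥ ⊔ Ideal.span {f}) g := h.2.1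
  have e1 := hilbertSeries_sup_span (Ideal.IsHomogeneous.bot _) hf h1
  rw [bot_sup_eq] at h2 e1
  rw [Ideal.span_insert, hilbertSeries_sup_span (isHomogeneous_span_form hf) hg h2, e1,
    ← one_sub_X_mul_geomPoly, ← one_sub_X_mul_geomPoly, Polynomial.coe_mul]
  linear_combination (1 - PowerSeries.X) ^ 2 * (geomPoly d : PowerSeries ℤ) *
    (geomPoly e : PowerSeries ℤ) * one_sub_X_pow_mul_hilbertSeries_bot (σ := σ) (k := k)

/-- Forms of large degree lie in a complete intersection of dimension zero. -/
lemma mem_of_sum_degrees_le {f g h : MvPolynomial σ k} {a b c : ℕ}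
    (hf : f.IsHomogeneous a) (hg : g.IsHomogeneous b) (hh : h.IsHomogeneous c)
    (ha : 0 < a) (hb : 0 < b) (hc : 0 < c)
    (hfg : RegularSeqMod ⊥ [f, g]) (hr : RegularMod (Ideal.span {f, g}) h)
    {ls : List (MvPolynomial σ k)} (hlin : ∀ l ∈ ls, l.IsHomogeneous 1)
    (hreg : RegularSeqMod (Ideal.span {f, g} ⊔ Ideal.span {h}) ls)
    (hlen : ls.length + 3 = Nat.card σ) {w : MvPolynomial σ k} {t : ℕ} (hw : w.IsHomogeneous t)
    (ht : a + b + c ≤ t + 2) : w ∈ Ideal.span {f, g} ⊔ Ideal.span {h} ⊔ Ideal.ofList ls := by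
  have hhom := isHomogeneous_span_pair hf hg
  have e1 := hilbertSeries_span_pair hf hg hfg
  have e2 := hilbertSeries_sup_ofList (hhom.sup (isHomogeneous_span_form hh)) hlin hreg
  rw [hilbertSeries_sup_span hhom hh hr, ← one_sub_X_mul_geomPoly] at e2
  have e3 : hilbertSeries (Ideal.span {f, g} ⊔ Ideal.span {h} ⊔ Ideal.ofList ls) =
      ((geomPoly a * geomPoly b * geomPoly c : Polynomial ℤ) : PowerSeries ℤ) := by
    refine mul_left_cancel₀ (pow_ne_zero 2 one_sub_X_ne_zero) ?_
    rw [e2, Polynomial.coe_mul (geomPoly a * geomPoly b)]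
    rw [← hlen] at e1
    linear_combination (geomPoly c : PowerSeries ℤ) * e1
  refine (hilbertFunction_eq_zero_iff _ t).1 ?_ w hw
  have h3 := congrArg (PowerSeries.coeff t) e3
  -- The degree is at most `(a - 1) + (b - 1) + (c - 1)`; positivity of `a`, `b`, `c` makes this `a
  -- + b + c - 3`.
  have hdeg : (geomPoly a * geomPoly b * geomPoly c).natDegree < t := by
    have := (Polynomial.natDegree_mul_le (p := geomPoly a * geomPoly b) (q := geomPoly c))
    have := (Polynomial.natDegree_mul_le (p := geomPoly a) (q := geomPoly b))
    have := natDegree_geomPoly_le a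
    have := natDegree_geomPoly_le b
    have := natDegree_geomPoly_le c
    omega
  rw [hilbertSeries, PowerSeries.coeff_mk, Polynomial.coeff_coe,
    Polynomial.coeff_eq_zero_of_natDegree_lt hdeg] at h3
  exact_mod_cast h3

end Artinian

/-! ### Generators and syzygies of the intersection. -/

section LinkedIdeals

variable {R : Type*} [CommRing R] {f₁ g₁ f₂ g₂ a₁ b₁ b₂ : R}

lemma RegularMod.ne_zero [Nontrivial R] {x : R} (h : RegularMod ⊥ x) : x ≠ 0 := by
  rintro rfl
  exact one_ne_zero (h 1 (by simp))

/-- With `F = f₂ - b₂ g₂ ∈ I₁`, an element `α f₂ + β g₂` equals `α F + (β + α b₂) g₂`. It lies in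
`I₁` exactly when `β + α b₂` does, as `g₂` is regular modulo `I₁`. -/
lemma inf_span_pair_eq (hg₂ : RegularMod (Ideal.span {f₁, g₁}) g₂)
    (hf : f₂ = a₁ * f₁ + b₁ * g₁ + b₂ * g₂) :
    Ideal.span {f₁, g₁} ⊓ Ideal.span {f₂, g₂} =
      Ideal.span {f₂ - b₂ * g₂, g₁ * g₂, f₁ * g₂} := by
  have hF : f₂ - b₂ * g₂ ∈ Ideal.span {f₁, g₁} :=
    Ideal.mem_span_pair.2 ⟨a₁, b₁, by rw [hf]; ring⟩
  apply le_antisymm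
  · rintro h ⟨h₁, h₂⟩
    obtain ⟨α, β, rfl⟩ := Ideal.mem_span_pair.1 h₂
    have h3 : β + α * b₂ ∈ Ideal.span {f₁, g₁} := by
      refine hg₂ _ ?_
      have : g₂ * (β + α * b₂) = α * f₂ + β * g₂ - α * (f₂ - b₂ * g₂) := by ring
      rw [this]
      exact Ideal.sub_mem _ h₁ (Ideal.mul_mem_left _ _ hF)
    obtain ⟨u, v, huv⟩ := Ideal.mem_span_pair.1 h3
    refine Ideal.mem_span_insert.2 ⟨α, _, Ideal.mem_span_pair.2 ⟨v, u, rfl⟩, ?_⟩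
    linear_combination -g₂ * huv
  · rw [Ideal.span_le]
    rintro _ (rfl | rfl | rfl)
    · exact ⟨hF, Ideal.mem_span_pair.2 ⟨1, -b₂, by ring⟩⟩
    · exact ⟨Ideal.mem_span_pair.2 ⟨0, g₂, by ring⟩, Ideal.mem_span_pair.2 ⟨0, g₁, by ring⟩⟩
    · exact ⟨Ideal.mem_span_pair.2 ⟨g₂, 0, by ring⟩, Ideal.mem_span_pair.2 ⟨0, f₁, by ring⟩⟩

lemma inf_sup_span_right_eq (hf : f₂ = a₁ * f₁ + b₁ * g₁ + b₂ * g₂) :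
    Ideal.span {f₁, g₁} ⊓ Ideal.span {f₂, g₂} ⊔ Ideal.span {g₂} = Ideal.span {f₂, g₂} := by
  apply le_antisymm
  · exact sup_le inf_le_right (Ideal.span_mono (by simp))
  · rw [Ideal.span_le]
    rintro x (hx | hx)
    · refine Submodule.mem_sup.2 ⟨f₂ - b₂ * g₂, ⟨Ideal.mem_span_pair.2 ⟨a₁, b₁, ?_⟩,
        Ideal.mem_span_pair.2 ⟨1, -b₂, by ring⟩⟩, b₂ * g₂,
        Ideal.mem_span_singleton'.2 ⟨b₂, rfl⟩, by rw [hx]; ring⟩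
      rw [hf]; ring
    · exact Submodule.mem_sup_right (hx ▸ Ideal.mem_span_singleton_self _)

lemma mem_iff_mul_mem_inf (hg₂ : RegularMod (Ideal.span {f₁, g₁}) g₂) (w : R) :
    w ∈ Ideal.span {f₁, g₁} ↔ g₂ * w ∈ Ideal.span {f₁, g₁} ⊓ Ideal.span {f₂, g₂} :=
  ⟨fun h => ⟨Ideal.mul_mem_left _ _ h, Ideal.mem_span_pair.2 ⟨0, w, by ring⟩⟩,
    fun h => hg₂ w h.1⟩

lemma maximalMinor_eq :
    maximalMinor !![-g₂, 0; b₁, f₁; a₁, -g₁] =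
      ![-(b₁ * g₁ + a₁ * f₁), g₁ * g₂, -(f₁ * g₂)] := by
  ext i
  fin_cases i
  · simp [maximalMinor, Matrix.det_fin_two]
    ring
  · simp [maximalMinor, Matrix.det_fin_two, Fin.succAbove]
    ring
  · simp [maximalMinor, Matrix.det_fin_two, Fin.succAbove]
    ring

variable [IsDomain R]

/-- The syzygies of the three generators. -/
lemma syzygy_iff (h₁ : RegularSeqMod ⊥ [f₁, g₁]) (h₂ : RegularSeqMod ⊥ [f₂, g₂])
    (hg₂ : g₂ ≠ 0) (hf : f₂ = a₁ * f₁ + b₁ * g₁ + b₂ * g₂) (y : Fin 3 → R) :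
    y 0 * (f₂ - b₂ * g₂) + y 1 * (g₁ * g₂) + y 2 * (f₁ * g₂) = 0 ↔
      y ∈ Set.range (Matrix.mulVecLin !![-g₂, 0; b₁, f₁; a₁, -g₁]) := by
  have hf₁ : f₁ ≠ 0 := RegularMod.ne_zero h₁.1
  have hf₂ : f₂ ≠ 0 := RegularMod.ne_zero h₂.1
  have r₁ : RegularMod (Ideal.span {f₁}) g₁ := by simpa using h₁.2.1
  have r₂ : RegularMod (Ideal.span {f₂}) g₂ := by simpa using h₂.2.1
  constructor
  · intro h
    -- The relation reads `y₀ f₂ = g₂ (y₀ b₂ - y₁ g₁ - y₂ f₁)`, so regularity of `f₂, g₂` forces `y₀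
    -- = c g₂`. Subtracting the corresponding multiple of the first column and cancelling `g₂`
    -- leaves a Koszul relation between `f₁` and `g₁`.
    obtain ⟨c, hc⟩ := Ideal.mem_span_singleton'.1 (r₂ (y 0 * b₂ - y 1 * g₁ - y 2 * f₁)
      (Ideal.mem_span_singleton'.2 ⟨y 0, by linear_combination h⟩))
    have h0 : y 0 = c * g₂ := by
      refine mul_right_cancel₀ hf₂ ?_
      linear_combination h - g₂ * hc
    have h3 : (y 1 + b₁ * c) * g₁ + (y 2 + a₁ * c) * f₁ = 0 := by
      refine mul_right_cancel₀ hg₂ ?_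
      rw [h0, hf] at h
      linear_combination h
    obtain ⟨v, hv⟩ := Ideal.mem_span_singleton'.1 (r₁ (y 1 + b₁ * c)
      (Ideal.mem_span_singleton'.2 ⟨-(y 2 + a₁ * c), by linear_combination -h3⟩))
    have h4 : y 2 + a₁ * c = -g₁ * v := by
      refine mul_right_cancel₀ hf₁ ?_
      linear_combination h3 + g₁ * hv
    refine ⟨![-c, v], ?_⟩
    ext i
    fin_cases i
    · simp [h0, mul_comm]
    · simp
      linear_combination hv
    · simp
      linear_combination -h4
  · rintro ⟨c, rfl⟩
    simp [Matrix.mulVec, dotProduct, Fin.sum_univ_two]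
    rw [hf]
    ring

lemma mulVecLin_injective (hf₁ : f₁ ≠ 0) (hg₂ : g₂ ≠ 0) :
    Function.Injective (Matrix.mulVecLin !![-g₂, 0; b₁, f₁; a₁, -g₁]) := by
  rw [← LinearMap.ker_eq_bot, LinearMap.ker_eq_bot']
  intro c hc
  have h0 := congrFun hc 0
  have h1 := congrFun hc 1
  simp [Matrix.mulVec, dotProduct, Fin.sum_univ_two, hg₂] at h0
  simp [Matrix.mulVec, dotProduct, Fin.sum_univ_two, hf₁, h0] at h1
  ext i
  fin_cases i
  exacts [h0, h1]

lemma isHilbertBurchMatrix (h₁ : RegularSeqMod ⊥ [f₁, g₁]) (h₂ : RegularSeqMod ⊥ [f₂, g₂])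
    (hr : RegularMod (Ideal.span {f₁, g₁}) g₂) (hg₂ : g₂ ≠ 0)
    (hf : f₂ = a₁ * f₁ + b₁ * g₁ + b₂ * g₂) :
    IsHilbertBurchMatrix !![-g₂, 0; b₁, f₁; a₁, -g₁]
      (Ideal.span {f₁, g₁} ⊓ Ideal.span {f₂, g₂}) where
  span_minors := by
    rw [inf_span_pair_eq hr hf, maximalMinor_eq]
    have : -(b₁ * g₁ + a₁ * f₁) = -(f₂ - b₂ * g₂) := by rw [hf]; ring
    rw [this]
    simp only [Matrix.range_cons, Matrix.range_empty, Set.union_empty, Ideal.span_union,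
      Ideal.span_insert, Ideal.span_singleton_neg]
  injective := mulVecLin_injective (RegularMod.ne_zero h₁.1) hg₂
  exact := by
    intro y
    -- The signed minors are the three generators, all with the sign `-1`; hence `neg_eq_zero`.
    rw [← syzygy_iff h₁ h₂ hg₂ hf, maximalMinor_eq, Fintype.linearCombination_apply,
      Fin.sum_univ_three, ← neg_eq_zero]
    refine Eq.congr_left ?_
    simp
    rw [hf]
    ring

end LinkedIdeals

/-! ### Degrees, homogeneous coefficients and minimality. -/

section Graded

variable {σ k : Type*} [Field k] {f₁ g₁ f₂ g₂ a₁ b₁ b₂ : MvPolynomial σ k} {d₁ e₁ d₂ e₂ : ℕ}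

/-- A form of degree `0` is zero or a unit. Regularity of zero would make `I` the whole ring, and a
unit would make the sum the whole ring. -/
lemma pos_degree_of_regularMod {I : Ideal (MvPolynomial σ k)} {x : MvPolynomial σ k} {c : ℕ}
    (hx : x.IsHomogeneous c) (h : RegularMod I x) (hI : I ⊔ Ideal.span {x} ≠ ⊤) : 0 < c := by
  by_contra hc
  obtain rfl : c = 0 := by omega
  rw [← totalDegree_zero_iff_isHomogeneous, totalDegree_eq_zero_iff_eq_C] at hx
  by_cases h0 : coeff 0 x = 0
  · rw [h0, map_zero] at hx
    refine hI (eq_top_iff.2 (le_sup_of_le_left ?_))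
    rw [top_le_iff, Ideal.eq_top_iff_one]
    exact h 1 (by simp [hx])
  · refine hI (eq_top_iff.2 (le_sup_of_le_right ?_))
    rw [top_le_iff, Ideal.span_singleton_eq_top, hx]
    exact (isUnit_iff_ne_zero.2 h0).map C

lemma form_mem_idealOfVars_iff {x : MvPolynomial σ k} {c : ℕ} (hx : x.IsHomogeneous c) :
    x ∈ idealOfVars σ k ↔ ¬ IsUnit x := by
  constructor
  · exact fun h hu => idealOfVars_ne_top (Ideal.eq_top_of_isUnit_mem _ h hu)
  · intro hu
    rcases Nat.eq_zero_or_pos c with rfl | hc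
    · rw [← totalDegree_zero_iff_isHomogeneous, totalDegree_eq_zero_iff_eq_C] at hx
      have : coeff 0 x = 0 := by
        by_contra h0
        exact hu (hx ▸ (isUnit_iff_ne_zero.2 h0).map C)
      rw [hx, this, map_zero]
      exact Ideal.zero_mem _
    · exact isHomogeneous_mem_idealOfVars hx hc

/-- Membership of a form in an ideal generated by three forms has a homogeneous witness. -/
lemma exists_forms_of_mem (hf₁ : f₁.IsHomogeneous d₁) (hg₁ : g₁.IsHomogeneous e₁)
    (hf₂ : f₂.IsHomogeneous d₂) (hg₂ : g₂.IsHomogeneous e₂)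
    (hd : d₁ ≤ d₂) (he₁ : e₁ ≤ d₂) (he₂ : e₂ ≤ d₂)
    (h : f₂ ∈ Ideal.span {f₁, g₁} ⊔ Ideal.span {g₂}) :
    ∃ a₁ b₁ b₂ : MvPolynomial σ k, a₁.IsHomogeneous (d₂ - d₁) ∧ b₁.IsHomogeneous (d₂ - e₁) ∧
      b₂.IsHomogeneous (d₂ - e₂) ∧ f₂ = a₁ * f₁ + b₁ * g₁ + b₂ * g₂ := by
  obtain ⟨u, hu, v, hv, e⟩ := Submodule.mem_sup.1 h
  obtain ⟨α, β, rfl⟩ := Ideal.mem_span_pair.1 hu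
  obtain ⟨γ, rfl⟩ := Ideal.mem_span_singleton'.1 hv
  refine ⟨homogeneousComponent (d₂ - d₁) α, homogeneousComponent (d₂ - e₁) β,
    homogeneousComponent (d₂ - e₂) γ, homogeneousComponent_isHomogeneous _ _,
    homogeneousComponent_isHomogeneous _ _, homogeneousComponent_isHomogeneous _ _, ?_⟩
  rw [← homogeneousComponent_mul_form hf₁, ← homogeneousComponent_mul_form hg₁,
    ← homogeneousComponent_mul_form hg₂, Nat.sub_add_cancel hd, Nat.sub_add_cancel he₁,
    Nat.sub_add_cancel he₂, ← map_add, ← map_add, e, homogeneousComponent_eq_self hf₂]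

lemma isGradedFreeResolution (hf₁ : f₁.IsHomogeneous d₁) (hg₁ : g₁.IsHomogeneous e₁)
    (hf₂ : f₂.IsHomogeneous d₂) (hg₂ : g₂.IsHomogeneous e₂)
    (hd : d₁ ≤ d₂) (he₁ : e₁ ≤ d₂) (he₂ : e₂ ≤ d₂)
    (h₁ : RegularSeqMod ⊥ [f₁, g₁]) (h₂ : RegularSeqMod ⊥ [f₂, g₂])
    (hr : RegularMod (Ideal.span {f₁, g₁}) g₂) (hg₀ : g₂ ≠ 0)
    (ha₁ : a₁.IsHomogeneous (d₂ - d₁)) (hb₁ : b₁.IsHomogeneous (d₂ - e₁))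
    (hb₂ : b₂.IsHomogeneous (d₂ - e₂)) (hf : f₂ = a₁ * f₁ + b₁ * g₁ + b₂ * g₂) :
    IsGradedFreeResolution ![d₂ + e₂, e₁ + e₂ + d₁] ![d₂, e₁ + e₂, d₁ + e₂]
      !![-g₂, 0; b₁, f₁; a₁, -g₁] ![f₂ - b₂ * g₂, g₁ * g₂, f₁ * g₂]
      (Ideal.span {f₁, g₁} ⊓ Ideal.span {f₂, g₂}) where
  homogeneous_gen := by
    intro i
    fin_cases i
    · have := hb₂.mul hg₂
      rw [Nat.sub_add_cancel he₂] at this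
      exact hf₂.sub this
    · exact hg₁.mul hg₂
    · exact hf₁.mul hg₂
  homogeneous_matrix := by
    have cast {x : MvPolynomial σ k} {m n : ℕ} (hx : x.IsHomogeneous m) (h : m = n) :
      x.IsHomogeneous n := h ▸ hx
    intro i j hij
    fin_cases i <;> fin_cases j <;> simp at hij ⊢
    · exact hg₂.neg
    · exact ⟨by omega, cast hb₁ (by omega)⟩
    · exact cast hf₁ (by omega)
    · exact ⟨by omega, cast ha₁ (by omega)⟩
    · exact ⟨by omega, cast hg₁.neg (by omega)⟩
  injective := mulVecLin_injective (RegularMod.ne_zero h₁.1) hg₀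
  exact := by
    intro y
    rw [← syzygy_iff h₁ h₂ hg₀ hf, Fintype.linearCombination_apply, Fin.sum_univ_three]
    rfl
  span_gen := by
    rw [inf_span_pair_eq hr hf]
    simp only [Matrix.range_cons, Matrix.range_empty, Set.union_empty, Ideal.span_union,
      Ideal.span_insert]

lemma entries_mem_idealOfVars_iff (hf₁ : f₁.IsHomogeneous d₁) (hg₁ : g₁.IsHomogeneous e₁)
    (hg₂ : g₂.IsHomogeneous e₂) (hd : 0 < d₁) (he₁ : 0 < e₁) (he₂ : 0 < e₂) {m n : ℕ}
    (ha₁ : a₁.IsHomogeneous m) (hb₁ : b₁.IsHomogeneous n) :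
    (∀ i j, !![-g₂, 0; b₁, f₁; a₁, -g₁] i j ∈ idealOfVars σ k) ↔ ¬ IsUnit a₁ ∧ ¬ IsUnit b₁ := by
  rw [← form_mem_idealOfVars_iff ha₁, ← form_mem_idealOfVars_iff hb₁]
  constructor
  · exact fun h => ⟨h 2 0, h 1 0⟩
  · rintro ⟨ha, hb⟩ i j
    have h1 := isHomogeneous_mem_idealOfVars hf₁ hd
    have h2 := isHomogeneous_mem_idealOfVars hg₁ he₁
    have h3 := isHomogeneous_mem_idealOfVars hg₂ he₂
    fin_cases i <;> fin_cases j
    exacts [Ideal.neg_mem_iff _ |>.2 h3, Ideal.zero_mem _, hb, h1, ha,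
      Ideal.neg_mem_iff _ |>.2 h2]

end Graded

/-! ### Coefficients of a product of two geometric sums. -/

section Coefficients

/-- The plateau: each of the `b` shifts of `geomPoly a` contributes `1` in degree `t`. -/
lemma coeff_geomPoly_mul_of_mem {a b t : ℕ} (h : b ≤ t + 1) (ht : t < a) :
    (geomPoly a * geomPoly b).coeff t = b := by
  rw [show geomPoly b = ∑ i ∈ Finset.range b, Polynomial.X ^ i from rfl, Finset.mul_sum,
    Polynomial.finsetSum_coeff]
  trans ∑ i ∈ Finset.range b, (1 : ℤ)
  · refine Finset.sum_congr rfl fun i hi => ?_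
    have := Finset.mem_range.1 hi
    rw [Polynomial.coeff_mul_X_pow', if_pos (by omega), coeff_geomPoly, if_pos (by omega)]
  · simp

lemma coeff_geomPoly_mul_top {a b t : ℕ} (ha : 0 < a) (hb : 0 < b) (ht : t + 2 = a + b) :
    (geomPoly a * geomPoly b).coeff t = 1 := by
  obtain rfl : t = (a - 1) + (b - 1) := by omega
  rw [Polynomial.coeff_mul_add_eq_of_natDegree_le (natDegree_geomPoly_le a)
    (natDegree_geomPoly_le b), coeff_geomPoly, coeff_geomPoly, if_pos (by omega),
    if_pos (by omega), one_mul]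

lemma coeff_geomPoly_mul_of_lt {a b t : ℕ} (ha : 0 < a) (hb : 0 < b) (ht : a + b < t + 2) :
    (geomPoly a * geomPoly b).coeff t = 0 := by
  refine Polynomial.coeff_eq_zero_of_natDegree_lt ?_
  have := Polynomial.natDegree_mul_le (p := geomPoly a) (q := geomPoly b)
  have := natDegree_geomPoly_le a
  have := natDegree_geomPoly_le b
  omega

end Coefficients

/-! ### Depth of the union, membership of `f₂`, and the Hilbert series of the intersection. -/

section Reduction

variable {k : Type*} [Field k] {r d₁ e₁ d₂ e₂ : ℕ} {f₁ g₁ f₂ g₂ : MvPolynomial (Fin (r + 1)) k}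

attribute [local instance] MvPolynomial.gradedAlgebra

/-- The quotient by `J` surjects onto the one by `(f₁, g₁)`, whose dimension is at least `r - 1` by
Krull, so the Cohen-Macaulay sequence has at least that length. -/
lemma hasDepth_of_isArithmeticallyCM (hf₁ : f₁ ∈ idealOfVars (Fin (r + 1)) k)
    (hg₁ : g₁ ∈ idealOfVars (Fin (r + 1)) k) {J : Ideal (MvPolynomial (Fin (r + 1)) k)}
    (hJ : J ≤ Ideal.span {f₁, g₁}) (hCM : IsArithmeticallyCM J) :
    HasDepth (idealOfVars (Fin (r + 1)) k) (r - 1) J := by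
  obtain ⟨rs, hrs, hreg, hlen⟩ := hCM
  have h1 := card_le_ringKrullDim_quotient_add_two hf₁ hg₁
  have h2 : ringKrullDim (MvPolynomial (Fin (r + 1)) k ⧸ Ideal.span {f₁, g₁}) ≤
      ringKrullDim (MvPolynomial (Fin (r + 1)) k ⧸ J) :=
    ringKrullDim_le_of_surjective (Ideal.Quotient.factor hJ)
      (Ideal.Quotient.factor_surjective hJ)
  have h3 : ((Nat.card (Fin (r + 1)) : ℕ) : WithBot ℕ∞) ≤ (rs.length : ℕ) + 2 := by
    rw [hlen]
    exact h1.trans (add_le_add_left h2 _)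
  have h4 : r + 1 ≤ rs.length + 2 := by
    rw [Nat.card_fin] at h3
    exact_mod_cast h3
  refine HasDepth.mono (by omega) (((isRegular_quotient_iff J rs).1 hreg).1.hasDepth fun x hx => ?_)
  obtain ⟨n, hn, hx⟩ := hrs x hx
  exact isHomogeneous_mem_idealOfVars hx hn

lemma hasDepth_span_pair [Infinite k] (hf₁ : f₁ ∈ idealOfVars (Fin (r + 1)) k)
    (hg₁ : g₁ ∈ idealOfVars (Fin (r + 1)) k) (h : RegularSeqMod ⊥ [f₁, g₁]) (hr : 1 ≤ r) :
    HasDepth (idealOfVars (Fin (r + 1)) k) (r - 1) (Ideal.span {f₁, g₁}) := by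
  obtain ⟨s, rfl⟩ := Nat.exists_eq_add_of_le' hr
  have h0 := hasDepth_bot (Fin (s + 1 + 1)) k
  rw [Nat.card_fin] at h0
  have h1 := (h0.sup_span h.1 hf₁).sup_span h.2.1 hg₁
  rwa [bot_sup_eq, ← Ideal.span_insert] at h1

/-- If the union is arithmetically Cohen-Macaulay and `f₂` has large degree, then `f₂` lies in the
ideal generated by `f₁`, `g₁` and `g₂`. -/
lemma mem_span_of_isArithmeticallyCM [Infinite k] (hr : 2 ≤ r)
    (hf₁ : f₁.IsHomogeneous d₁) (hg₁ : g₁.IsHomogeneous e₁)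
    (hf₂ : f₂.IsHomogeneous d₂) (hg₂ : g₂.IsHomogeneous e₂)
    (hd₁ : 0 < d₁) (he₁ : 0 < e₁) (hd₂ : 0 < d₂) (he₂ : 0 < e₂)
    (h₁ : RegularSeqMod ⊥ [f₁, g₁]) (h₂ : RegularSeqMod ⊥ [f₂, g₂])
    (h₃ : RegularMod (Ideal.span {f₁, g₁}) g₂)
    (hCM : IsArithmeticallyCM (Ideal.span {f₁, g₁} ⊓ Ideal.span {f₂, g₂}))
    (hdeg : d₁ + e₁ + e₂ ≤ d₂ + 2) : f₂ ∈ Ideal.span {f₁, g₁} ⊔ Ideal.span {g₂} := by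
  have mf₁ := isHomogeneous_mem_idealOfVars hf₁ hd₁
  have mg₁ := isHomogeneous_mem_idealOfVars hg₁ he₁
  have mf₂ := isHomogeneous_mem_idealOfVars hf₂ hd₂
  have mg₂ := isHomogeneous_mem_idealOfVars hg₂ he₂
  have D₁ := hasDepth_span_pair mf₁ mg₁ h₁ (by omega)
  have D₂ := hasDepth_span_pair mf₂ mg₂ h₂ (by omega)
  have DJ := hasDepth_of_isArithmeticallyCM mf₁ mg₁ inf_le_left hCM
  obtain ⟨m, rfl⟩ := Nat.exists_eq_add_of_le' hr
  obtain ⟨ls, hlen, hlin, hreg, hmem⟩ := exists_linear_seq_of_mem_imp hf₂ (m := m)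
    ((isHomogeneous_span_pair hf₁ hg₁).sup (isHomogeneous_span_form hg₂))
    (by rw [Ideal.span_insert f₂, sup_assoc, sup_comm (Ideal.span {g₂})]) DJ D₁ D₂
    (HasDepth.sup_span D₁ h₃ mg₂)
  exact hmem (mem_of_sum_degrees_le hf₁ hg₁ hg₂ hd₁ he₁ he₂ h₁ h₃ hlin hreg
    (by rw [hlen, Nat.card_fin]) hf₂ hdeg)

lemma isHomogeneous_inf_span_pair (hf₁ : f₁.IsHomogeneous d₁) (hg₁ : g₁.IsHomogeneous e₁)
    (hf₂ : f₂.IsHomogeneous d₂) (hg₂ : g₂.IsHomogeneous e₂) :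
    (Ideal.span {f₁, g₁} ⊓ Ideal.span {f₂, g₂}).IsHomogeneous
      (homogeneousSubmodule (Fin (r + 1)) k) :=
  (isHomogeneous_span_pair hf₁ hg₁).inf (isHomogeneous_span_pair hf₂ hg₂)

/-- Multiplication by `g₂` embeds `(R/I₁)(-e₂)` in `R/(I₁ ⊓ I₂)` with cokernel `R/I₂`. -/
lemma hilbertSeries_inf (hf₁ : f₁.IsHomogeneous d₁) (hg₁ : g₁.IsHomogeneous e₁)
    (hf₂ : f₂.IsHomogeneous d₂) (hg₂ : g₂.IsHomogeneous e₂)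
    (h₁ : RegularSeqMod ⊥ [f₁, g₁]) (h₂ : RegularSeqMod ⊥ [f₂, g₂])
    (h₃ : RegularMod (Ideal.span {f₁, g₁}) g₂) {a₁ b₁ b₂ : MvPolynomial (Fin (r + 1)) k}
    (hf : f₂ = a₁ * f₁ + b₁ * g₁ + b₂ * g₂) :
    (1 - PowerSeries.X : PowerSeries ℤ) ^ Nat.card (Fin (r + 1)) *
        hilbertSeries (Ideal.span {f₁, g₁} ⊓ Ideal.span {f₂, g₂}) =
      (1 - PowerSeries.X) ^ 2 * ((geomPoly d₁ * geomPoly e₁ * Polynomial.X ^ e₂ +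
        geomPoly d₂ * geomPoly e₂ : Polynomial ℤ) : PowerSeries ℤ) := by
  have e1 := hilbertSeries_span_pair hf₁ hg₁ h₁
  have e2 := hilbertSeries_span_pair hf₂ hg₂ h₂
  have e3 := hilbertSeries_eq_add
    (isHomogeneous_inf_span_pair hf₁ hg₁ hf₂ hg₂) hg₂
    (mem_iff_mul_mem_inf (f₂ := f₂) h₃)
  rw [inf_sup_span_right_eq hf] at e3
  rw [e3, Polynomial.coe_add, Polynomial.coe_mul (_ * _), Polynomial.coe_pow, Polynomial.coe_X]
  linear_combination e2 + PowerSeries.X ^ e₂ * e1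

end Reduction

lemma artinianHilbertFunction_natCast {σ k : Type*} [Field k]
    {I : Ideal (MvPolynomial σ k)} {ls : List (MvPolynomial σ k)} {q : Polynomial ℤ}
    (h : hilbertSeries (I ⊔ Ideal.ofList ls) = (q : PowerSeries ℤ)) (t : ℕ) :
    (artinianHilbertFunction I ls t : ℤ) = q.coeff t := by
  have := congrArg (PowerSeries.coeff t) h
  rwa [hilbertSeries, PowerSeries.coeff_mk, Polynomial.coeff_coe] at this

theorem mainTheorem6 {k : Type*} [Field k] [IsAlgClosed k] (r : ℕ) (hr : 2 ≤ r)
    (d₁ e₁ d₂ e₂ : ℕ) (f₁ g₁ f₂ g₂ : MvPolynomial (Fin (r + 1)) k)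
    (hf₁ : f₁.IsHomogeneous d₁) (hg₁ : g₁.IsHomogeneous e₁)
    (hf₂ : f₂.IsHomogeneous d₂) (hg₂ : g₂.IsHomogeneous e₂)
    (I₁ I₂ : Ideal (MvPolynomial (Fin (r + 1)) k))
    (hI₁ : I₁ = Ideal.span {f₁, g₁}) (hI₂ : I₂ = Ideal.span {f₂, g₂})
    (hX₁ : RingTheory.Sequence.IsRegular (MvPolynomial (Fin (r + 1)) k) [f₁, g₁])
    (hX₂ : RingTheory.Sequence.IsRegular (MvPolynomial (Fin (r + 1)) k) [f₂, g₂])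
    (hCM : IsArithmeticallyCM (I₁ ⊓ I₂))
    (hdeg : d₁ + e₁ + e₂ ≤ d₂ + 2)
    (hreg : RingTheory.Sequence.IsRegular (MvPolynomial (Fin (r + 1)) k) [f₁, g₁, g₂]) :
    -- `f₂ = a₁ f₁ + b₁ g₁ + b₂ g₂` for suitable forms `a₁, b₁, b₂`
    (∃ a₁ b₁ b₂ : MvPolynomial (Fin (r + 1)) k,
      (d₁ ≤ d₂ ∧ e₁ ≤ d₂ ∧ e₂ ≤ d₂) ∧
      a₁.IsHomogeneous (d₂ - d₁) ∧ b₁.IsHomogeneous (d₂ - e₁) ∧ b₂.IsHomogeneous (d₂ - e₂) ∧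
      f₂ = a₁ * f₁ + b₁ * g₁ + b₂ * g₂) ∧
    -- Hilbert-Burch matrix and generators, for any such expression of `f₂`
    (∀ a₁ b₁ b₂ : MvPolynomial (Fin (r + 1)) k, f₂ = a₁ * f₁ + b₁ * g₁ + b₂ * g₂ →
      IsHilbertBurchMatrix !![-g₂, 0; b₁, f₁; a₁, -g₁] (I₁ ⊓ I₂) ∧
      I₁ ⊓ I₂ = Ideal.span {f₂ - b₂ * g₂, g₁ * g₂, f₁ * g₂}) ∧
    -- the graded free resolution and its minimality, for expressions by forms
    (∀ a₁ b₁ b₂ : MvPolynomial (Fin (r + 1)) k,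
      a₁.IsHomogeneous (d₂ - d₁) → b₁.IsHomogeneous (d₂ - e₁) → b₂.IsHomogeneous (d₂ - e₂) →
      f₂ = a₁ * f₁ + b₁ * g₁ + b₂ * g₂ →
      IsGradedFreeResolution ![d₂ + e₂, e₁ + e₂ + d₁] ![d₂, e₁ + e₂, d₁ + e₂]
        !![-g₂, 0; b₁, f₁; a₁, -g₁] ![f₂ - b₂ * g₂, g₁ * g₂, f₁ * g₂] (I₁ ⊓ I₂) ∧
      (IsMinimalGradedFreeResolution ![d₂ + e₂, e₁ + e₂ + d₁] ![d₂, e₁ + e₂, d₁ + e₂]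
          !![-g₂, 0; b₁, f₁; a₁, -g₁] ![f₂ - b₂ * g₂, g₁ * g₂, f₁ * g₂] (I₁ ⊓ I₂) ↔
        ¬ IsUnit a₁ ∧ ¬ IsUnit b₁) ∧
      (d₂ ≠ d₁ → d₂ ≠ e₁ →
        IsMinimalGradedFreeResolution ![d₂ + e₂, e₁ + e₂ + d₁] ![d₂, e₁ + e₂, d₁ + e₂]
          !![-g₂, 0; b₁, f₁; a₁, -g₁] ![f₂ - b₂ * g₂, g₁ * g₂, f₁ * g₂] (I₁ ⊓ I₂))) ∧
    -- Artinian reductions exist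
    ((∃ ls, IsArtinianReduction (I₁ ⊓ I₂) ls) ∧
      (∃ ls, IsArtinianReduction I₁ ls) ∧ (∃ ls, IsArtinianReduction I₂ ls)) ∧
    -- the Hilbert function of the Artinian reduction
    (∀ ls ls₁ ls₂, IsArtinianReduction (I₁ ⊓ I₂) ls →
      IsArtinianReduction I₁ ls₁ → IsArtinianReduction I₂ ls₂ → ∀ t : ℤ,
        artinianHilbertFunction (I₁ ⊓ I₂) ls t =
          artinianHilbertFunction I₁ ls₁ (t - e₂) + artinianHilbertFunction I₂ ls₂ t) ∧
    -- failure of decreasing type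
    (d₁ + e₁ + e₂ < d₂ → ∀ ls, IsArtinianReduction (I₁ ⊓ I₂) ls →
      ¬ IsOfDecreasingType (artinianHilbertFunction (I₁ ⊓ I₂) ls)) := by
  subst hI₁ hI₂
  obtain ⟨s₁, n₁⟩ := (isRegular_self_iff _).1 hX₁
  obtain ⟨s₂, n₂⟩ := (isRegular_self_iff _).1 hX₂
  obtain ⟨s₃, n₃⟩ := (isRegular_self_iff _).1 hreg
  have r₁ : RegularMod (Ideal.span {f₁}) g₁ := by simpa using s₁.2.1
  have r₂ : RegularMod (Ideal.span {f₂}) g₂ := by simpa using s₂.2.1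
  have r₃ : RegularMod (Ideal.span {f₁, g₁}) g₂ := by
    simpa [Ideal.span_insert] using s₃.2.2.1
  have t₃ : Ideal.span {f₁, g₁} ⊔ Ideal.span {g₂} ≠ ⊤ := by
    simpa [Ideal.span_insert, sup_assoc] using n₃
  have t₁ : Ideal.span {f₁} ⊔ Ideal.span {g₁} ≠ ⊤ := by simpa using n₁
  have t₂ : Ideal.span {f₂} ⊔ Ideal.span {g₂} ≠ ⊤ := by simpa using n₂
  have hd₁ : 0 < d₁ := pos_degree_of_regularMod hf₁ s₁.1
    (by rw [bot_sup_eq]; exact ne_top_of_le_ne_top t₁ le_sup_left)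
  have hd₂ : 0 < d₂ := pos_degree_of_regularMod hf₂ s₂.1
    (by rw [bot_sup_eq]; exact ne_top_of_le_ne_top t₂ le_sup_left)
  have he₁ : 0 < e₁ := pos_degree_of_regularMod hg₁ r₁ t₁
  have he₂ : 0 < e₂ := pos_degree_of_regularMod hg₂ r₂ t₂
  have hg₀ : g₂ ≠ 0 := by
    rintro rfl
    refine t₃ (eq_top_iff.2 (le_sup_of_le_left ?_))
    rw [top_le_iff, Ideal.eq_top_iff_one]
    exact r₃ 1 (by simp)
  -- These three bounds use positivity of the degrees: the hypothesis is `d₂ ≥ d₁ + (e₁ - 1) + (e₂ -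
  -- 1)`, and symmetrically.
  have hd : d₁ ≤ d₂ := by omega
  have hde : e₁ ≤ d₂ := by omega
  have hee : e₂ ≤ d₂ := by omega
  have : Infinite k := IsAlgClosed.instInfinite
  obtain ⟨a₁, b₁, b₂, ha₁, hb₁, hb₂, hf⟩ := exists_forms_of_mem hf₁ hg₁ hf₂ hg₂ hd hde hee
    (mem_span_of_isArithmeticallyCM hr hf₁ hg₁ hf₂ hg₂ hd₁ he₁ hd₂ he₂ s₁ s₂ r₃ hCM hdeg)
  have mf₁ := isHomogeneous_mem_idealOfVars hf₁ hd₁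
  have mg₁ := isHomogeneous_mem_idealOfVars hg₁ he₁
  have mf₂ := isHomogeneous_mem_idealOfVars hf₂ hd₂
  have mg₂ := isHomogeneous_mem_idealOfVars hg₂ he₂
  have hom₁ := isHomogeneous_span_pair hf₁ hg₁
  have hom₂ := isHomogeneous_span_pair hf₂ hg₂
  have homJ := isHomogeneous_inf_span_pair hf₁ hg₁ hf₂ hg₂
  have le₁ : Ideal.span {f₁, g₁} ≤ idealOfVars (Fin (r + 1)) k := by
    rw [Ideal.span_le]
    rintro _ (rfl | rfl)
    exacts [mf₁, mg₁]
  have le₂ : Ideal.span {f₂, g₂} ≤ idealOfVars (Fin (r + 1)) k := by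
    rw [Ideal.span_le]
    rintro x (hx | hx)
    exacts [hx ▸ mf₂, hx ▸ mg₂]
  have hs₁ := hilbertSeries_span_pair hf₁ hg₁ s₁
  have hs₂ := hilbertSeries_span_pair hf₂ hg₂ s₂
  have hsJ := hilbertSeries_inf hf₁ hg₁ hf₂ hg₂ s₁ s₂ r₃ hf
  have q₁ : (geomPoly d₁ * geomPoly e₁).eval 1 ≠ 0 := by
    simp only [Polynomial.eval_mul, eval_one_geomPoly]
    positivity
  have q₂ : (geomPoly d₂ * geomPoly e₂).eval 1 ≠ 0 := by
    simp only [Polynomial.eval_mul, eval_one_geomPoly]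
    positivity
  have qJ : (geomPoly d₁ * geomPoly e₁ * Polynomial.X ^ e₂ +
      geomPoly d₂ * geomPoly e₂).eval 1 ≠ 0 := by
    simp only [Polynomial.eval_add, Polynomial.eval_mul, Polynomial.eval_pow, Polynomial.eval_X,
      eval_one_geomPoly, one_pow, mul_one]
    positivity
  have hcard : r - 1 + 2 = Nat.card (Fin (r + 1)) := by
    rw [Nat.card_fin]
    omega
  refine ⟨⟨a₁, b₁, b₂, ⟨hd, hde, hee⟩, ha₁, hb₁, hb₂, hf⟩, ?_, ?_, ⟨?_, ?_, ?_⟩, ?_, ?_⟩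
  · intro a₁ b₁ b₂ hf
    exact ⟨isHilbertBurchMatrix s₁ s₂ r₃ hg₀ hf, inf_span_pair_eq r₃ hf⟩
  · intro a₁ b₁ b₂ ha₁ hb₁ hb₂ hf
    have hres := isGradedFreeResolution hf₁ hg₁ hf₂ hg₂ hd hde hee s₁ s₂ r₃ hg₀ ha₁ hb₁ hb₂ hf
    have hiff := entries_mem_idealOfVars_iff hf₁ hg₁ hg₂ hd₁ he₁ he₂ ha₁ hb₁
    refine ⟨hres, ⟨fun h => hiff.1 h.minimal, fun h => ⟨hres, hiff.2 h⟩⟩, fun h h' =>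
      ⟨hres, hiff.2 ?_⟩⟩
    rw [← form_mem_idealOfVars_iff ha₁, ← form_mem_idealOfVars_iff hb₁]
    exact ⟨isHomogeneous_mem_idealOfVars ha₁ (by omega),
      isHomogeneous_mem_idealOfVars hb₁ (by omega)⟩
  · exact exists_isArtinianReduction homJ (inf_le_left.trans le₁) hcard hsJ
      (hasDepth_of_isArithmeticallyCM mf₁ mg₁ inf_le_left hCM)
  · exact exists_isArtinianReduction hom₁ le₁ hcard hs₁
      (hasDepth_span_pair mf₁ mg₁ s₁ (by omega))
  · exact exists_isArtinianReduction hom₂ le₂ hcard hs₂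
      (hasDepth_span_pair mf₂ mg₂ s₂ (by omega))
  · intro ls ls₁ ls₂ hls hls₁ hls₂ t
    have EJ := artinianHilbertFunction_natCast (hls.hilbertSeries_eq homJ qJ hsJ)
    have E₁ := artinianHilbertFunction_natCast (hls₁.hilbertSeries_eq hom₁ q₁ hs₁)
    have E₂ := artinianHilbertFunction_natCast (hls₂.hilbertSeries_eq hom₂ q₂ hs₂)
    rcases lt_or_ge t 0 with ht | ht
    · simp only [artinianHilbertFunction]
      rw [hilbertFunction_of_neg _ ht, hilbertFunction_of_neg _ ht,
        hilbertFunction_of_neg _ (by omega)]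
    · lift t to ℕ using ht
      zify
      rw [EJ, E₂, Polynomial.coeff_add, Polynomial.coeff_mul_X_pow']
      congr 1
      split_ifs with h
      · rw [← E₁, Nat.cast_sub h]
      · rw [artinianHilbertFunction, hilbertFunction_of_neg _ (by omega), Nat.cast_zero]
  · intro hlt ls hls hdec
    have EJ := artinianHilbertFunction_natCast (hls.hilbertSeries_eq homJ qJ hsJ)
    -- Here `u = d₁ + e₁ - 2` is the last degree where the summand of `I₁` is nonzero, with value
    -- `1`. In degrees `u + e₂`, `u + e₂ + 1`, `u + e₂ + 2` the function is `e₂ + 1`, `e₂`, `e₂`;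
    -- the last degree is `d₁ + e₁ + e₂ < d₂`, still on the plateau.
    obtain ⟨u, hu⟩ := Nat.exists_eq_add_of_le (show 2 ≤ d₁ + e₁ by omega)
    have v0 := EJ (u + e₂)
    have v1 := EJ (u + e₂ + 1)
    have v2 := EJ (u + e₂ + 2)
    rw [Polynomial.coeff_add, Polynomial.coeff_mul_X_pow', if_pos (by omega),
      coeff_geomPoly_mul_of_mem (a := d₂) (b := e₂) (by omega) (by omega)] at v0 v1 v2
    rw [coeff_geomPoly_mul_top hd₁ he₁ (by omega)] at v0
    rw [coeff_geomPoly_mul_of_lt hd₁ he₁ (by omega)] at v1 v2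
    have h1 := hdec ((u + e₂ : ℕ) : ℤ) (by
      zify
      push_cast at v0 v1 ⊢
      omega) ((u + e₂ + 1 : ℕ) : ℤ) (by push_cast; omega) (by
      zify
      push_cast at v1 ⊢
      omega)
    zify at h1
    push_cast at v1 v2 h1
    rw [show (u + e₂ + 1 + 1 : ℤ) = u + e₂ + 2 by ring] at h1
    omega
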